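/- A cube complex $X$ (of arbitrary, possibly infinite, dimension) is CAT(0) if it is simply connected and all its vertex links are flag complexes. Let $\mathcal H(X)$ be its set of half-spaces, $\overline H$ the half-space complementary to $H$, and $d$ the combinatorial distance on vertices. Call $H,K$ transverse if $H\cap K$, $H\cap\overline K$, $\overline H\cap K$, $\overline H\cap\overline K$ all contain a vertex. Let $g$ be a hyperbolic automorphism of $X$: $gH\neq\overline H$ for every half-space $H$, and $\ell_g=\min_x d(x,gx)>0$, where $x$ ranges over the vertices. A combinatorial axis of $g$ is a bi-infinite edge geodesic on which $g$ acts as a translation by $\ell_g$, oriented in the direction of translation. Let $A_g^+$ be the set of half-spaces $H$ such that some axis has an oriented edge $(x,y)$ with $x\notin H$, $y\in H$, and let $A_g=A_g^+\cup\{\overline H: H\in A_g^+\}$ be the half-space axis of $g$. The essential characteristic set $X_g^{\mathrm{ess}}$ is the cube complex $X(A_g)$ given by the Sageev construction. Its vertices are the subsets $\sigma\subseteq A_g$ that contain exactly one of $H,\overline H$ for each $H\in A_g$, contain no two disjoint half-spaces, and differ in only finitely many elements from $\pi(v)=\{H\in A_g: v\in H\}$ for some (equivalently, every) vertex $v$ of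 $X$. Two vertices are adjacent if they differ by replacing one $H$ with $\overline H$, and there is a cube wherever the $1$-skeleton of a cube is present. Each $H\in A_g$ defines the half-space $\{\sigma : H\in\sigma\}$ of $X_g^{\mathrm{ess}}$. The minimal set $M_g$ is the full subcomplex of $X$ spanned by the vertices $x$ with $d(x,gx)=\ell_g$, and the essential minimal set $M_g^{\mathrm{ess}}\subseteq X_g^{\mathrm{ess}}$ is the image of $M_g$ under the projection induced by $v\mapsto\pi(v)$. Say that $\langle g\rangle$ acts non-transversely on $X_g^{\mathrm{ess}}$ if for every $H\in A_g$ the half-spaces of $X_g^{\mathrm{ess}}$ defined by $H$ and $gH$ are not transverse in $X_g^{\mathrm{ess}}$. **Proposition.** $M_g^{\mathrm{ess}}=X_g^{\mathrm{ess}}$ if and only if $\langle g\rangle$ acts non-transversely on $X_g^{\mathrm{ess}}$. Moreover, $\langle g\rangle$ acts non-transversely on $X_g^{\mathrm{ess}}$ if and only if there is no $H\in A_g$ such that $H$ and $gH$ are transverse in $X$. -/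

import Mathlib

/-- A face of the combinatorial cube `{0,1}^n`: fix some of the coordinates. -/
def IsCubeFace {n : ℕ} (F : Set (Fin n → Bool)) : Prop :=
  ∃ (I : Set (Fin n)) (a : Fin n → Bool), F = {x | ∀ i ∈ I, x i = a i}

/-- A cube complex with vertex set `V`, of arbitrary (possibly infinite) dimension, recorded by the
vertex sets of its cubes. Every cube is identified with some `{0,1}^n` in such a way that the cubes
contained in it are exactly its faces, and two cubes that meet do so in a common face. -/
structure CubeComplex (V : Type*) where
  cubes : Set (Set V)
  singleton_mem : ∀ v : V, {v} ∈ cubes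
  exists_chart : ∀ C ∈ cubes, ∃ (n : ℕ) (φ : (Fin n → Bool) → V),
    Function.Injective φ ∧ Set.range φ = C ∧
      ∀ S ⊆ C, (S ∈ cubes ↔ ∃ F : Set (Fin n → Bool), IsCubeFace F ∧ S = φ '' F)
  inter_mem : ∀ C ∈ cubes, ∀ D ∈ cubes, (C ∩ D).Nonempty → C ∩ D ∈ cubes

/-- Two subsets of the vertex set are transverse if all four intersections of one of them or its
complement with the other or its complement are non-empty. -/
def Transverse {V : Type*} (H K : Set V) : Prop :=
  (H ∩ K).Nonempty ∧ (H ∩ Kᶜ).Nonempty ∧ (Hᶜ ∩ K).Nonempty ∧ (Hᶜ ∩ Kᶜ).Nonempty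

namespace CubeComplex

variable {V : Type*} (X : CubeComplex V)

/-- The `1`-skeleton. -/
def graph : SimpleGraph V where
  Adj x y := x ≠ y ∧ {x, y} ∈ X.cubes
  symm := ⟨fun x y h => ⟨h.1.symm, by rw [Set.pair_comm]; exact h.2⟩⟩
  loopless := ⟨fun _ h => h.1 rfl⟩

/-- `a, b, c, d` are the vertices of a square of `X`, in cyclic order. -/
def IsSquare (a b c d : V) : Prop :=
  {a, b, c, d} ∈ X.cubes ∧ a ≠ c ∧ b ≠ d ∧
    X.graph.Adj a b ∧ X.graph.Adj b c ∧ X.graph.Adj a d ∧ X.graph.Adj d c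

/-- The simplices (including the empty one) of the link of the vertex `v`. The vertices of the link
are the edges of `X` at `v`, represented by their other end points; every cube `C` that contains
`v` contributes the simplex spanned by the edges of `C` at `v`. -/
def linkSimplices (v : V) : Set (Set V) :=
  {S | ∃ C ∈ X.cubes, v ∈ C ∧ S = {w | w ∈ C ∧ X.graph.Adj v w}}

/-- Non-positive curvature: every vertex link is a flag complex, that is, finitely many vertices of
the link that are pairwise joined by edges of the link span a simplex of the link. -/
def IsNonpositivelyCurved : Prop :=
  ∀ (v : V) (S : Set V), S.Finite → (∀ a ∈ S, {a} ∈ X.linkSimplices v) →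
    (∀ a ∈ S, ∀ b ∈ S, a ≠ b → {a, b} ∈ X.linkSimplices v) → S ∈ X.linkSimplices v

/-- Homotopy of edge paths relative to their end points: generated by removing (or inserting)
backtracks and by pushing a path across a square. -/
inductive Homotopic : ∀ {x y : V}, X.graph.Walk x y → X.graph.Walk x y → Prop
  | refl {x y : V} (p : X.graph.Walk x y) : Homotopic p p
  | symm {x y : V} {p q : X.graph.Walk x y} : Homotopic p q → Homotopic q p
  | trans {x y : V} {p q r : X.graph.Walk x y} : Homotopic p q → Homotopic q r → Homotopic p r
  | cons {x y z : V} (h : X.graph.Adj x y) {p q : X.graph.Walk y z} :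
      Homotopic p q → Homotopic (SimpleGraph.Walk.cons h p) (SimpleGraph.Walk.cons h q)
  | backtrack {x y z : V} (h : X.graph.Adj x y) (p : X.graph.Walk x z) :
      Homotopic (SimpleGraph.Walk.cons h (SimpleGraph.Walk.cons h.symm p)) p
  | square {a b c d z : V} (_ : X.IsSquare a b c d)
      (hab : X.graph.Adj a b) (hbc : X.graph.Adj b c)
      (had : X.graph.Adj a d) (hdc : X.graph.Adj d c) (p : X.graph.Walk c z) :
      Homotopic (SimpleGraph.Walk.cons hab (SimpleGraph.Walk.cons hbc p))
        (SimpleGraph.Walk.cons had (SimpleGraph.Walk.cons hdc p))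

/-- Non-empty, connected, and every closed edge path is null-homotopic. -/
def IsSimplyConnected : Prop :=
  X.graph.Connected ∧ ∀ (x : V) (p : X.graph.Walk x x), X.Homotopic p SimpleGraph.Walk.nil

/-- A cube complex is CAT(0) if it is non-positively curved and simply connected. -/
def IsCAT0 : Prop :=
  X.IsNonpositivelyCurved ∧ X.IsSimplyConnected

/-- The two edges are opposite edges of a square. -/
def OppositeEdges (e f : Sym2 V) : Prop :=
  ∃ a b c d : V, X.IsSquare a b c d ∧ e = s(a, b) ∧ f = s(d, c)

/-- The hyperplane dual to the edge `e`, recorded by the set of all edges that it crosses. -/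
def hyperplane (e : Sym2 V) : Set (Sym2 V) :=
  {f | Relation.EqvGen X.OppositeEdges e f}

/-- A half-space, recorded by its set of vertices: a connected component of the complement of a
hyperplane. The complementary half-space of `H` is `Hᶜ`. -/
def IsHalfspace (H : Set V) : Prop :=
  ∃ e ∈ X.graph.edgeSet,
    ∃ c : (X.graph.deleteEdges (X.hyperplane e)).ConnectedComponent, H = c.supp

/-- The interval `[x, y]`: the half-spaces that contain `y` but not `x`. If `x, y` are adjacent,
its unique element is the half-space dual to the oriented edge `(x, y)`. -/
def interval (x y : V) : Set (Set V) :=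
  {H | X.IsHalfspace H ∧ y ∈ H ∧ x ∉ H}

/-- A permutation of the vertices that induces an automorphism of the cube complex. -/
def IsAutomorphism (g : Equiv.Perm V) : Prop :=
  ∀ C : Set V, g '' C ∈ X.cubes ↔ C ∈ X.cubes

/-- `g` maps no half-space to its complementary half-space. -/
def ActsWithoutInversion (g : Equiv.Perm V) : Prop :=
  ∀ H : Set V, X.IsHalfspace H → g '' H ≠ Hᶜ

/-- The translation distance: the minimum over all vertices `v` of the combinatorial distance from
`v` to `g v`. -/
noncomputable def translationDistance (g : Equiv.Perm V) : ℕ :=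
  sInf (Set.range fun v : V => X.graph.dist v (g v))

/-- A hyperbolic automorphism: it acts without inversion and has positive translation distance. -/
structure IsHyperbolic (g : Equiv.Perm V) : Prop where
  isAutomorphism : X.IsAutomorphism g
  actsWithoutInversion : X.ActsWithoutInversion g
  translationDistance_pos : 0 < X.translationDistance g

/-- A combinatorial axis, parametrized in the forward direction: a bi-infinite geodesic on which
`g` acts as the translation by `translationDistance g`. -/
def IsCombinatorialAxis (g : Equiv.Perm V) (γ : ℤ → V) : Prop :=
  (∀ i j : ℤ, X.graph.dist (γ i) (γ j) = (i - j).natAbs) ∧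
    ∀ i : ℤ, g (γ i) = γ (i + X.translationDistance g)

/-- The positive half-space axis: half-spaces dual to positively oriented edges of axes. -/
def positiveAxis (g : Equiv.Perm V) : Set (Set V) :=
  {H | ∃ γ : ℤ → V, X.IsCombinatorialAxis g γ ∧ ∃ i : ℤ, H ∈ X.interval (γ i) (γ (i + 1))}

/-- The full half-space axis: the positive half-space axis and the complementary half-spaces. -/
def halfspaceAxis (g : Equiv.Perm V) : Set (Set V) :=
  X.positiveAxis g ∪ {H | Hᶜ ∈ X.positiveAxis g}

/-- The cubes of the minimal set of `g`, the full subcomplex spanned by the vertices that realize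
the translation distance. -/
def minimalSet (g : Equiv.Perm V) : Set (Set V) :=
  {C | C ∈ X.cubes ∧ ∀ v ∈ C, X.graph.dist v (g v) = X.translationDistance g}

end CubeComplex

namespace Sageev

variable {V : Type*} (P : Set (Set V))

/-- `σ` is an ultrafilter on the collection `P` of half-spaces: it contains exactly one half-space
of each complementary pair, and no two of its elements are disjoint. -/
def IsUltrafilter (σ : Set (Set V)) : Prop :=
  σ ⊆ P ∧ (∀ H ∈ P, Xor (H ∈ σ) (Hᶜ ∈ σ)) ∧ ∀ H ∈ σ, ∀ K ∈ σ, (H ∩ K).Nonempty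

/-- The half-spaces of `P` that contain the vertex `v`. -/
def principal (v : V) : Set (Set V) :=
  {H | H ∈ P ∧ v ∈ H}

/-- The vertices of the cube complex `X(P)` of the Sageev construction: the ultrafilters on `P`
that differ from the one determined by a vertex in only finitely many half-spaces. -/
def vertices : Set (Set (Set V)) :=
  {σ | IsUltrafilter P σ ∧ ∃ v : V, (symmDiff σ (principal P v)).Finite}

/-- Two vertices of `X(P)` are adjacent if they differ on exactly one complementary pair. -/
def Adjacent (σ τ : Set (Set V)) : Prop :=
  ∃ H ∈ σ, τ = insert Hᶜ (σ \ {H})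

/-- The cubes of `X(P)`, recorded by their vertex sets: there is a cube wherever the `1`-skeleton
of a cube is present. -/
def cubes : Set (Set (Set (Set V))) :=
  {Q | ∃ (n : ℕ) (φ : (Fin n → Bool) → Set (Set V)),
    Function.Injective φ ∧ Set.range φ = Q ∧ (∀ a, φ a ∈ vertices P) ∧
      ∀ (a : Fin n → Bool) (i : Fin n), Adjacent (φ a) (φ (Function.update a i (!(a i))))}

/-- The half-space of `X(P)` that corresponds to `H ∈ P`, recorded by its set of vertices. -/
def halfspace (H : Set V) : Set (Set (Set V)) :=
  {σ | σ ∈ vertices P ∧ H ∈ σ}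

/-- The half-spaces of `X(P)` that correspond to `H, K ∈ P` are transverse in `X(P)`. -/
def TransverseIn (H K : Set V) : Prop :=
  (halfspace P H ∩ halfspace P K).Nonempty ∧ (halfspace P H ∩ halfspace P Kᶜ).Nonempty ∧
    (halfspace P Hᶜ ∩ halfspace P K).Nonempty ∧ (halfspace P Hᶜ ∩ halfspace P Kᶜ).Nonempty

end Sageev

namespace CubeComplex

variable {V : Type*} (X : CubeComplex V)

/-- The essential characteristic set of `g`: the cube complex of the Sageev construction on the
half-space axis of `g`, given by its cubes. -/
def essentialCharacteristicSet (g : Equiv.Perm V) : Set (Set (Set (Set V))) :=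
  Sageev.cubes (X.halfspaceAxis g)

/-- The essential minimal set of `g`: the projection of the minimal set to the essential
characteristic set, given by its cubes. The projection maps a vertex `v` to the set of those
half-spaces of the axis that contain `v`. -/
def essentialMinimalSet (g : Equiv.Perm V) : Set (Set (Set (Set V))) :=
  {Q | ∃ C ∈ X.minimalSet g, Q = Sageev.principal (X.halfspaceAxis g) '' C}

/-- The group generated by `g` acts non-transversely on the essential characteristic set. -/
def ActsNonTransversely (g : Equiv.Perm V) : Prop :=
  ∀ H ∈ X.halfspaceAxis g, ¬ Sageev.TransverseIn (X.halfspaceAxis g) H (g '' H)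

end CubeComplex

/-! Write `A` for the half-space axis and `ℓ` for the translation distance. The equivalence of the
two notions of transversality is formal. Two half-spaces in a common ultrafilter intersect by
definition, and conversely a vertex of `X` in both gives a principal ultrafilter containing both
(`transverseIn_iff`).

For the main equivalence, both conditions are compared with `gH ⊆ H` for all `H` in the positive
axis.

Transversality: three of the four intersections of `H` with `gH` are never empty, as the far ends of
`⟨g⟩`-orbits and one axis vertex show. So failure of transversality gives `gH ⊆ H`
(`image_subset_of_not_transverse`), and the inclusion excludes transversality.

From `M_g^ess = X_g^ess` to inclusion: at a minimal vertex the `⟨g⟩`-orbit runs along a geodesic, so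
convexity turns `x ∈ gH` into `x ∈ H` (`mem_of_mem_image_of_minimal`). Every vertex has the same
projection as some minimal vertex, hence obeys the same implication.

From inclusion to `M_g^ess = X_g^ess`: let `γ` be an axis. Helly and gates realize each vertex of
`X(A)` by a vertex of the hull of `γ` (`exists_principal_eq`). Half-spaces separating points of the
hull lie in `A`, so cubes lift too (`exists_cube`). If `gH ⊆ H` throughout the positive axis, a hull
vertex `x` is separated from `gx` by at most one half-space per `⟨g⟩`-orbit. There are at most `ℓ`
orbits, so `x` is minimal (`dist_eq_of_mem_axisHull`). Without an axis, `X(A)` is a point.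

The CAT(0) geometry is derived from links and homotopies. Edges act on reduced paths modulo square
swaps, compatibly with homotopy. This yields the parity of distances, the quadrangle condition, and
then half-spaces as convex metric sides, gates and the Helly property. -/

namespace CubeComplex

/-- Change the `i`-th coordinate of a vertex of the combinatorial cube. -/
def flipCoord {n : ℕ} (a : Fin n → Bool) (i : Fin n) : Fin n → Bool :=
  Function.update a i (!(a i))

/-! ### Combinatorial cubes and their faces. -/

section flipCoord

variable {n : ℕ}

@[simp] lemma flipCoord_same (a : Fin n → Bool) (i : Fin n) : flipCoord a i i = !(a i) := by
  simp [flipCoord]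

lemma flipCoord_of_ne (a : Fin n → Bool) {i j : Fin n} (h : j ≠ i) : flipCoord a i j = a j := by
  simp [flipCoord, h]

lemma flipCoord_ne (a : Fin n → Bool) (i : Fin n) : flipCoord a i ≠ a := fun h => by
  have := congrFun h i
  simp at this

@[simp] lemma flipCoord_flipCoord (a : Fin n → Bool) (i : Fin n) :
    flipCoord (flipCoord a i) i = a := by
  simp [flipCoord]

lemma flipCoord_comm (a : Fin n → Bool) (i j : Fin n) :
    flipCoord (flipCoord a i) j = flipCoord (flipCoord a j) i := by
  rcases eq_or_ne i j with rfl | h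
  · rfl
  · ext k
    by_cases hi : k = i <;> by_cases hj : k = j <;> simp_all [flipCoord]

lemma flipCoord_injective (a : Fin n → Bool) : Function.Injective (flipCoord a) := by
  intro i j h
  by_contra hij
  have := congrFun h i
  rw [flipCoord_same, flipCoord_of_ne _ hij] at this
  simp at this

lemma flipCoord_flipCoord_ne (a : Fin n → Bool) {i j : Fin n} (h : i ≠ j) :
    flipCoord (flipCoord a i) j ≠ a := fun e => h <| by
  apply flipCoord_injective a
  rw [← e, flipCoord_flipCoord, e]

/-- A function on the combinatorial cube that does not change under flips of the coordinates in `I`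
depends only on the other coordinates. -/
lemma eq_of_forall_flipCoord {β : Type*} {f : (Fin n → Bool) → β} {I : Set (Fin n)}
    (hf : ∀ a, ∀ i ∈ I, f (flipCoord a i) = f a) {a b : Fin n → Bool}
    (hab : ∀ i ∉ I, a i = b i) : f a = f b := by
  -- Change `a` into `b` one coordinate at a time; each genuine change is a flip in `I`.
  have key : ∀ s : Finset (Fin n), f (s.piecewise b a) = f a := by
    intro s
    induction s using Finset.induction with
    | empty => simp
    | insert j s hj ih =>
      rw [Finset.piecewise_insert]
      by_cases h : s.piecewise b a j = b j
      · rw [← h, Function.update_eq_self, ih]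
      · have h' : b j = !(s.piecewise b a j) := by
          cases h1 : b j <;> cases h2 : s.piecewise b a j <;> simp_all
        have hjI : j ∈ I := by
          by_contra hjI
          apply h
          rw [Finset.piecewise_eq_of_notMem _ _ _ hj, hab j hjI]
        rw [h', ← ih]
        exact hf _ j hjI
  simpa using (key Finset.univ).symm

lemma isCubeFace_edge (a : Fin n → Bool) (i : Fin n) : IsCubeFace {a, flipCoord a i} := by
  refine ⟨{i}ᶜ, a, ?_⟩
  ext x
  simp only [Set.mem_insert_iff, Set.mem_singleton_iff, Set.mem_compl_iff, Set.mem_ofPred_eq]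
  constructor
  · rintro (rfl | rfl) j hj
    · rfl
    · exact flipCoord_of_ne _ hj
  · intro h
    by_cases hi : x i = a i
    · left; ext j; by_cases hj : j = i
      · rw [hj, hi]
      · rw [h j hj]
    · right; ext j; by_cases hj : j = i
      · subst hj; rw [flipCoord_same]; cases h1 : x j <;> cases h2 : a j <;> simp_all
      · rw [h j hj, flipCoord_of_ne _ hj]

lemma isCubeFace_square (a : Fin n → Bool) (i j : Fin n) :
    IsCubeFace {a, flipCoord a i, flipCoord (flipCoord a i) j, flipCoord a j} := by
  rcases eq_or_ne i j with rfl | hij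
  · have : ({a, flipCoord a i, flipCoord (flipCoord a i) i, flipCoord a i} :
        Set (Fin n → Bool)) = {a, flipCoord a i} := by
      ext x; simp
    rw [this]
    exact isCubeFace_edge a i
  refine ⟨{i, j}ᶜ, a, ?_⟩
  ext x
  simp only [Set.mem_insert_iff, Set.mem_singleton_iff, Set.mem_compl_iff, Set.mem_ofPred_eq, not_or]
  constructor
  · rintro (rfl | rfl | rfl | rfl) k ⟨hki, hkj⟩ <;> simp [flipCoord, hki, hkj]
  · intro h
    have key : ∀ y : Fin n → Bool, x i = y i → x j = y j →
        (∀ k, k ≠ i → k ≠ j → y k = a k) → x = y := by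
      intro y hi hj hk
      ext k
      by_cases h1 : k = i
      · rw [h1, hi]
      · by_cases h2 : k = j
        · rw [h2, hj]
        · rw [h k ⟨h1, h2⟩, hk k h1 h2]
    have hb : ∀ {p q : Bool}, p ≠ q → p = !q := by decide
    by_cases hi : x i = a i <;> by_cases hj : x j = a j
    · exact Or.inl (key _ hi hj fun _ _ _ => rfl)
    · refine Or.inr (Or.inr (Or.inr (key _ ?_ ?_ ?_)))
      · rw [flipCoord_of_ne _ hij, hi]
      · rw [flipCoord_same, hb hj]
      · intro k h1 h2; rw [flipCoord_of_ne _ h2]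
    · refine Or.inr (Or.inl (key _ ?_ ?_ ?_))
      · rw [flipCoord_same, hb hi]
      · rw [flipCoord_of_ne _ hij.symm, hj]
      · intro k h1 h2; rw [flipCoord_of_ne _ h1]
    · refine Or.inr (Or.inr (Or.inl (key _ ?_ ?_ ?_)))
      · rw [flipCoord_of_ne _ hij, flipCoord_same, hb hi]
      · rw [flipCoord_same, flipCoord_of_ne _ hij.symm, hb hj]
      · intro k h1 h2; rw [flipCoord_of_ne _ h2, flipCoord_of_ne _ h1]

end flipCoord

/-! ### Charts of cubes, and squares. -/

variable {V : Type*} {X : CubeComplex V}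

/-- An identification of a cube of `X` with a combinatorial cube. -/
structure IsChart (X : CubeComplex V) {n : ℕ} (φ : (Fin n → Bool) → V) : Prop where
  injective : Function.Injective φ
  range_mem : Set.range φ ∈ X.cubes
  mem_cubes_iff : ∀ S ⊆ Set.range φ,
    (S ∈ X.cubes ↔ ∃ F : Set (Fin n → Bool), IsCubeFace F ∧ S = φ '' F)

lemma exists_isChart {C : Set V} (hC : C ∈ X.cubes) :
    ∃ (n : ℕ) (φ : (Fin n → Bool) → V), X.IsChart φ ∧ Set.range φ = C := by
  obtain ⟨n, φ, h1, rfl, h3⟩ := X.exists_chart C hC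
  exact ⟨n, φ, ⟨h1, hC, h3⟩, rfl⟩

lemma ncard_cube {C : Set V} (hC : C ∈ X.cubes) : ∃ n : ℕ, C.ncard = 2 ^ n := by
  obtain ⟨n, φ, h, rfl⟩ := exists_isChart hC
  refine ⟨n, ?_⟩
  rw [← Set.image_univ, Set.ncard_image_of_injective _ h.injective, Set.ncard_univ]
  simp

namespace IsSquare

variable {a b c d : V}

lemma rotate (h : X.IsSquare a b c d) : X.IsSquare b c d a := by
  obtain ⟨h1, h2, h3, h4, h5, h6, h7⟩ := h
  refine ⟨?_, h3, h2.symm, h5, h7.symm, h4.symm, h6⟩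
  convert h1 using 1
  ext x; simp; tauto

lemma reflect (h : X.IsSquare a b c d) : X.IsSquare a d c b := by
  obtain ⟨h1, h2, h3, h4, h5, h6, h7⟩ := h
  refine ⟨?_, h2, h3.symm, h6, h7, h4, h5⟩
  convert h1 using 1
  ext x; simp; tauto

/-- A square is determined by one of its corners. -/
lemma unique {c' : V} (h : X.IsSquare a b c d) (h' : X.IsSquare a b c' d) : c = c' := by
  by_contra hne
  have hi := X.inter_mem _ h.1 _ h'.1 ⟨a, by simp, by simp⟩
  obtain ⟨h1, h2, h3, h4, h5, h6, h7⟩ := h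
  obtain ⟨h1', h2', h3', h4', h5', h6', h7'⟩ := h'
  -- Distinct squares with this common corner would meet in three vertices, but cubes meet in cubes
  -- and three is not a power of two.
  have : ({a, b, c, d} ∩ {a, b, c', d} : Set V) = {a, b, d} := by
    ext x
    simp only [Set.mem_inter_iff, Set.mem_insert_iff, Set.mem_singleton_iff]
    constructor
    · rintro ⟨rfl | rfl | rfl | rfl, h⟩ <;> simp_all
    · tauto
  rw [this] at hi
  obtain ⟨n, hn⟩ := ncard_cube hi
  rw [Set.ncard_eq_three.2 ⟨a, b, d, h4.ne, h6.ne, h3, rfl⟩] at hn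
  rcases n with _ | n
  · simp at hn
  · rw [pow_succ] at hn; omega

end IsSquare

namespace IsChart

variable {n : ℕ} {φ : (Fin n → Bool) → V}

lemma adj_iff (h : X.IsChart φ) (a b : Fin n → Bool) :
    X.graph.Adj (φ a) (φ b) ↔ ∃ i, b = flipCoord a i := by
  constructor
  · rintro ⟨hne, hC⟩
    rw [h.mem_cubes_iff _ (by rintro x (rfl | rfl) <;> simp), ← Set.image_pair] at hC
    obtain ⟨F, ⟨I, c, rfl⟩, hF⟩ := hC
    replace hF := h.injective.image_injective hF
    have hab : a ≠ b := fun e => hne (by rw [e])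
    obtain ⟨i, hi⟩ := Function.ne_iff.1 hab
    have ha : a ∈ ({a, b} : Set (Fin n → Bool)) := by simp
    have hb : b ∈ ({a, b} : Set (Fin n → Bool)) := by simp
    -- A face containing `a` and `b` leaves every coordinate where they differ free, so it also
    -- contains this flip, which can only be `b`.
    have hf : flipCoord a i ∈ ({a, b} : Set (Fin n → Bool)) := by
      rw [hF] at ha hb ⊢
      intro j hj
      have : j ≠ i := by
        rintro rfl
        exact hi ((ha j hj).trans (hb j hj).symm)
      rw [flipCoord_of_ne _ this]
      exact ha j hj
    rcases hf with hf | hf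
    · exact absurd hf (flipCoord_ne a i)
    · exact ⟨i, hf.symm⟩
  · rintro ⟨i, rfl⟩
    refine ⟨fun e => flipCoord_ne a i (h.injective e.symm), ?_⟩
    rw [h.mem_cubes_iff _ (by rintro x (rfl | rfl) <;> simp)]
    exact ⟨_, isCubeFace_edge a i, by rw [Set.image_pair]⟩

lemma adj (h : X.IsChart φ) (a : Fin n → Bool) (i : Fin n) :
    X.graph.Adj (φ a) (φ (flipCoord a i)) :=
  (h.adj_iff _ _).2 ⟨i, rfl⟩

lemma isSquare (h : X.IsChart φ) (a : Fin n → Bool) {i j : Fin n} (hij : i ≠ j) :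
    X.IsSquare (φ a) (φ (flipCoord a i)) (φ (flipCoord (flipCoord a i) j))
      (φ (flipCoord a j)) := by
  refine ⟨?_, ?_, ?_, h.adj _ _, h.adj _ _, h.adj _ _, ?_⟩
  · rw [h.mem_cubes_iff _ (by rintro x (rfl | rfl | rfl | rfl) <;> simp)]
    exact ⟨_, isCubeFace_square a i j, by simp [Set.image_insert_eq]⟩
  · exact fun e => flipCoord_flipCoord_ne a hij (h.injective e).symm
  · exact fun e => hij (flipCoord_injective a (h.injective e))
  · rw [flipCoord_comm]
    exact h.adj _ _

end IsChart

/-! ### Flag links: filling corners by cubes. -/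

section Links

/-- Backtracks change the length by two and squares not at all; with simple connectivity this makes
the graph bipartite. -/
lemma Homotopic.length_mod_two {x y : V} {p q : X.graph.Walk x y} (h : X.Homotopic p q) :
    p.length % 2 = q.length % 2 := by
  induction h <;> (try simp only [SimpleGraph.Walk.length_cons]) <;> omega

lemma IsCAT0.even_length (hX : X.IsCAT0) {x : V} (p : X.graph.Walk x x) : p.length % 2 = 0 := by
  simpa using (hX.2.2 x p).length_mod_two

lemma singleton_mem_linkSimplices {v a : V} (h : X.graph.Adj v a) :
    {a} ∈ X.linkSimplices v := by
  refine ⟨{v, a}, h.2, by simp, ?_⟩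
  ext w
  simp only [Set.mem_singleton_iff, Set.mem_insert_iff, Set.mem_ofPred_eq]
  constructor
  · rintro rfl; exact ⟨Or.inr rfl, h⟩
  · rintro ⟨rfl | rfl, h'⟩
    · exact absurd h' (X.graph.loopless.irrefl _)
    · rfl

/-- The opposite corner `c` must not count as a neighbour of `v`: an edge `vc` would close up a walk
of length three. -/
lemma IsCAT0.pair_mem_linkSimplices (hX : X.IsCAT0) {v a b c : V} (h : X.IsSquare v a c b) :
    {a, b} ∈ X.linkSimplices v := by
  obtain ⟨h1, h2, h3, h4, h5, h6, h7⟩ := h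
  refine ⟨_, h1, by simp, ?_⟩
  ext w
  simp only [Set.mem_singleton_iff, Set.mem_insert_iff, Set.mem_ofPred_eq]
  constructor
  · rintro (rfl | rfl)
    · exact ⟨by simp, h4⟩
    · exact ⟨by simp, h6⟩
  · rintro ⟨rfl | rfl | rfl | rfl, h'⟩
    · exact absurd h' (X.graph.loopless.irrefl _)
    · exact Or.inl rfl
    · have := hX.even_length (.cons h4 (.cons h5 (.cons h'.symm .nil)))
      simp at this
    · exact Or.inr rfl

/-- Finitely many edges at `v` that pairwise span squares are the edges at `v` of a cube. -/
lemma IsCAT0.exists_chart_of_pairwise (hX : X.IsCAT0) {v : V} {S : Set V} (hS : S.Finite)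
    (hadj : ∀ a ∈ S, X.graph.Adj v a)
    (hsq : ∀ a ∈ S, ∀ b ∈ S, a ≠ b → ∃ c, X.IsSquare v a c b) :
    ∃ (n : ℕ) (φ : (Fin n → Bool) → V) (o : Fin n → Bool), X.IsChart φ ∧ φ o = v ∧
      S = Set.range fun i => φ (flipCoord o i) := by
  obtain ⟨C, hC, hv, hSC⟩ := hX.1 v S hS (fun a ha => singleton_mem_linkSimplices (hadj a ha))
    (fun a ha b hb hab => (hsq a ha b hb hab).elim fun c hc => hX.pair_mem_linkSimplices hc)
  obtain ⟨n, φ, hφ, rfl⟩ := exists_isChart hC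
  obtain ⟨o, rfl⟩ := hv
  refine ⟨n, φ, o, hφ, rfl, ?_⟩
  rw [hSC]
  ext w
  constructor
  · rintro ⟨⟨b, rfl⟩, hw⟩
    obtain ⟨i, rfl⟩ := (hφ.adj_iff _ _).1 hw
    exact ⟨i, rfl⟩
  · rintro ⟨i, rfl⟩
    exact ⟨⟨_, rfl⟩, hφ.adj _ _⟩

/-- Three squares that pairwise share an edge at `o` are contained in a `3`-cube. -/
lemma IsCAT0.exists_corner (hX : X.IsCAT0) {o a b c ab bc ac : V} (h1 : X.IsSquare o a ab b)
    (h2 : X.IsSquare o b bc c) (h3 : X.IsSquare o a ac c) :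
    ∃ t, X.IsSquare a ab t ac ∧ X.IsSquare b ab t bc ∧ X.IsSquare c ac t bc := by
  obtain ⟨n, φ, x, hφ, rfl, hS⟩ := hX.exists_chart_of_pairwise (v := o) (S := {a, b, c})
    (by simp) (by
      rintro _ (rfl | rfl | rfl)
      exacts [h1.2.2.2.1, h2.2.2.2.1, h2.2.2.2.2.2.1]) (by
      rintro _ (rfl | rfl | rfl) _ (rfl | rfl | rfl) hne
      exacts [absurd rfl hne, ⟨_, h1⟩, ⟨_, h3⟩, ⟨_, h1.reflect⟩, absurd rfl hne, ⟨_, h2⟩,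
        ⟨_, h3.reflect⟩, ⟨_, h2.reflect⟩, absurd rfl hne])
  have ha : a ∈ ({a, b, c} : Set V) := by simp
  have hb : b ∈ ({a, b, c} : Set V) := by simp
  have hc : c ∈ ({a, b, c} : Set V) := by simp
  rw [hS] at ha hb hc
  obtain ⟨i, rfl⟩ := ha
  obtain ⟨j, rfl⟩ := hb
  obtain ⟨k, rfl⟩ := hc
  have hij : i ≠ j := by rintro rfl; exact h1.2.2.1 rfl
  have hjk : j ≠ k := by rintro rfl; exact h2.2.2.1 rfl
  have hik : i ≠ k := by rintro rfl; exact h3.2.2.1 rfl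
  obtain rfl := (hφ.isSquare x hij).unique h1
  obtain rfl := (hφ.isSquare x hjk).unique h2
  obtain rfl := (hφ.isSquare x hik).unique h3
  refine ⟨φ (flipCoord (flipCoord (flipCoord x i) j) k), hφ.isSquare _ hjk, ?_, ?_⟩
  · have := hφ.isSquare (flipCoord x j) hik
    rwa [flipCoord_comm x j i] at this
  · have := hφ.isSquare (flipCoord x k) hij
    rwa [flipCoord_comm x k i, flipCoord_comm x k j, flipCoord_comm (flipCoord x i) k j] at this

end Links

/-! ### Paths modulo square swaps. -/

/-- Edge paths, recorded by the lists of their vertices from the end to the start, that differ by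
pushing across squares. -/
inductive SwapEquiv (X : CubeComplex V) : List V → List V → Prop
  | refl (p : List V) : SwapEquiv X p p
  | symm {p q : List V} : SwapEquiv X p q → SwapEquiv X q p
  | trans {p q r : List V} : SwapEquiv X p q → SwapEquiv X q r → SwapEquiv X p r
  | cons (z : V) {p q : List V} : SwapEquiv X p q → SwapEquiv X (z :: p) (z :: q)
  | swap {z y x y' : V} (h : X.IsSquare z y x y') (l : List V) :
      SwapEquiv X (z :: y :: x :: l) (z :: y' :: x :: l)

namespace SwapEquiv

variable {p q l l' : List V} {x y z : V}

lemma length_eq (h : X.SwapEquiv p q) : p.length = q.length := by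
  induction h <;> simp_all

lemma head?_eq (h : X.SwapEquiv p q) : p.head? = q.head? := by
  induction h <;> simp_all

lemma head_eq (h : X.SwapEquiv (y :: l) (z :: l')) : y = z := by
  simpa using h.head?_eq

/-- The two ways in which paths with tails `l, l'` and the same end `z` can be equivalent. -/
def TailEquiv (X : CubeComplex V) (z : V) (l l' : List V) : Prop :=
  X.SwapEquiv l l' ∨ ∃ y y' x r, X.IsSquare z y x y' ∧ X.SwapEquiv l (y :: x :: r) ∧
    X.SwapEquiv l' (y' :: x :: r)

lemma TailEquiv.symm (h : TailEquiv X z l l') : TailEquiv X z l' l := by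
  rcases h with h | ⟨y, y', x, r, h1, h2, h3⟩
  · exact Or.inl h.symm
  · exact Or.inr ⟨y', y, x, r, h1.reflect, h3, h2⟩

/-- The essential case has a square on each side. Induction applied to the middle tail either
identifies the squares or yields a third one at `y'`. In the latter case the three squares span a
cube, whose corner opposite `y'` completes the square that joins the outer two paths at `z`. -/
lemma TailEquiv.trans (hX : X.IsCAT0) {l₁ l₂ l₃ : List V}
    (ih : ∀ (z : V) (l l' : List V), l.length < l₂.length → X.SwapEquiv (z :: l) (z :: l') →
      TailEquiv X z l l')
    (h : TailEquiv X z l₁ l₂) (h' : TailEquiv X z l₂ l₃) : TailEquiv X z l₁ l₃ := by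
  rcases h with h | ⟨y, y', x, r, h1, h2, h3⟩
  · rcases h' with h' | ⟨y, y', x, r, h1, h2, h3⟩
    · exact Or.inl (h.trans h')
    · exact Or.inr ⟨y, y', x, r, h1, h.trans h2, h3⟩
  · rcases h' with h' | ⟨y₁, y₂, x₁, r₁, h1', h2', h3'⟩
    · exact Or.inr ⟨y, y', x, r, h1, h2, h'.symm.trans h3⟩
    · have hs := h3.symm.trans h2'
      obtain rfl := hs.head_eq
      rcases ih y' (x :: r) (x₁ :: r₁) (by simp [h3.length_eq]) hs with
        hs | ⟨u, u', w, s, hw, hu, hu'⟩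
      · obtain rfl := hs.head_eq
        obtain rfl := h1.rotate.rotate.rotate.unique h1'.rotate.reflect
        exact Or.inl ((h2.trans (hs.cons y)).trans h3'.symm)
      · obtain rfl := hu.head_eq
        obtain rfl := hu'.head_eq
        obtain ⟨t, ht1, ht2, ht3⟩ := hX.exists_corner (o := y') (a := z) (b := x) (c := x₁)
          (h1.rotate.rotate.rotate) hw (h1'.rotate.reflect)
        refine Or.inr ⟨y, y₂, t, w :: s, ht1, ?_, ?_⟩
        · exact (h2.trans (hu.cons y)).trans (.swap ht2.rotate.reflect s)
        · exact (h3'.trans (hu'.cons y₂)).trans (.swap ht3.rotate.reflect s)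

/-- Double induction: the outer one, on length, supplies the hypothesis of `TailEquiv.trans`; the
inner one follows the derivation of the equivalence. -/
lemma exists_tailEquiv (hX : X.IsCAT0) : ∀ (n : ℕ) {p q : List V}, p.length ≤ n →
    X.SwapEquiv p q → p = q ∨ ∃ z l l', p = z :: l ∧ q = z :: l' ∧ TailEquiv X z l l' := by
  intro n
  induction n with
  | zero =>
    intro p q hn h
    left
    rw [List.eq_nil_of_length_eq_zero (Nat.le_zero.1 hn), eq_comm,
      ← List.length_eq_zero_iff, ← h.length_eq]
    omega
  | succ n ih =>
    intro p q hn h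
    induction h with
    | refl p => exact Or.inl rfl
    | symm h ih' =>
      rcases ih' (by rw [h.length_eq]; exact hn) with h | ⟨z, l, l', h1, h2, h3⟩
      · exact Or.inl h.symm
      · exact Or.inr ⟨z, l', l, h2, h1, h3.symm⟩
    | trans h h' ih1 ih2 =>
      rcases ih1 hn with rfl | ⟨z, l, l', rfl, rfl, h3⟩
      · exact ih2 hn
      rcases ih2 (h.length_eq ▸ hn) with rfl | ⟨z', l₁, l₁', h4, rfl, h6⟩
      · exact Or.inr ⟨z, l, l', rfl, rfl, h3⟩
      · obtain ⟨rfl, rfl⟩ := List.cons.inj h4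
        refine Or.inr ⟨z, l, l₁', rfl, rfl, h3.trans hX ?_ h6⟩
        intro w m m' hm hs
        have hl := h.length_eq
        simp only [List.length_cons] at hn hl
        rcases ih (by simp only [List.length_cons]; omega) hs with h | ⟨z', k, k', h7, h8, h9⟩
        · exact Or.inl ((List.cons.inj h).2 ▸ .refl _)
        · obtain ⟨rfl, rfl⟩ := List.cons.inj h7
          obtain ⟨-, rfl⟩ := List.cons.inj h8
          exact h9
    | cons z h => exact Or.inr ⟨z, _, _, rfl, rfl, Or.inl h⟩
    | swap h l => exact Or.inr ⟨_, _, _, rfl, rfl, Or.inr ⟨_, _, _, l, h, .refl _, .refl _⟩⟩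

lemma tailEquiv (hX : X.IsCAT0) (h : X.SwapEquiv (z :: l) (z :: l')) : TailEquiv X z l l' := by
  rcases exists_tailEquiv hX _ le_rfl h with h | ⟨z', k, k', h7, h8, h9⟩
  · exact Or.inl ((List.cons.inj h).2 ▸ .refl _)
  · obtain ⟨rfl, rfl⟩ := List.cons.inj h7
    obtain ⟨-, rfl⟩ := List.cons.inj h8
    exact h9

/-- Equivalent paths with the same last edge. -/
lemma tail (hX : X.IsCAT0) (h : X.SwapEquiv (z :: y :: l) (z :: y :: l')) :
    X.SwapEquiv (y :: l) (y :: l') := by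
  rcases h.tailEquiv hX with h | ⟨a, b, x, r, h1, h2, h3⟩
  · exact h
  · exact absurd (h2.head_eq.symm.trans h3.head_eq) h1.2.2.1

/-- Equivalent paths with different last edges. -/
lemma exists_square (hX : X.IsCAT0) (h : X.SwapEquiv (z :: x :: l) (z :: y :: l'))
    (hxy : x ≠ y) : ∃ w r, X.IsSquare z x w y ∧ X.SwapEquiv (x :: l) (x :: w :: r) ∧
      X.SwapEquiv (y :: l') (y :: w :: r) := by
  rcases h.tailEquiv hX with h | ⟨a, b, w, r, h1, h2, h3⟩
  · exact absurd h.head_eq hxy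
  · obtain rfl := h2.head_eq
    obtain rfl := h3.head_eq
    exact ⟨w, r, h1, h2, h3⟩

end SwapEquiv

/-! ### Reduced paths and their extension by an edge. -/

/-- Up to pushing across squares, the last edge of `p` starts at `z`. -/
def CanPop (X : CubeComplex V) (p : List V) (z : V) : Prop :=
  ∃ y m, X.SwapEquiv p (y :: z :: m)

lemma SwapEquiv.canPop_iff {p q : List V} (h : X.SwapEquiv p q) (z : V) :
    X.CanPop p z ↔ X.CanPop q z :=
  ⟨fun ⟨y, m, h'⟩ => ⟨y, m, h.symm.trans h'⟩, fun ⟨y, m, h'⟩ => ⟨y, m, h.trans h'⟩⟩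

/-- A path without backtracks, even up to pushing across squares. -/
def Reduced (X : CubeComplex V) : List V → Prop
  | [] => True
  | z :: p => Reduced X p ∧ ¬ X.CanPop p z

/-- A cancellation available after the swap is, by the same square, already available before it, one
edge earlier or later along the path. -/
lemma Reduced.swap (hX : X.IsCAT0) {z y x y' : V} {l : List V} (hs : X.IsSquare z y x y')
    (h : X.Reduced (z :: y :: x :: l)) : X.Reduced (z :: y' :: x :: l) := by
  obtain ⟨⟨h1, h2⟩, h3⟩ := h
  refine ⟨⟨h1, ?_⟩, ?_⟩
  · rintro ⟨w, s, hw⟩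
    obtain rfl := hw.head_eq
    exact h3 ⟨y, y' :: s, (hw.cons y).trans (.swap hs.rotate s)⟩
  · rintro ⟨w, m, hw⟩
    obtain rfl := hw.head_eq
    obtain ⟨u, r, hu, h4, -⟩ := hw.exists_square hX hs.2.1.symm
    obtain rfl := hu.reflect.unique hs.rotate.rotate.rotate
    exact h2 ⟨x, r, h4⟩

lemma SwapEquiv.reduced_iff (hX : X.IsCAT0) {p q : List V} (h : X.SwapEquiv p q) :
    X.Reduced p ↔ X.Reduced q := by
  induction h with
  | refl p => rfl
  | symm h ih => exact ih.symm
  | trans h h' ih ih' => exact ih.trans ih'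
  | cons z h ih => simp only [Reduced, ih, h.canPop_iff]
  | swap h l => exact ⟨fun h' => h'.swap hX h, fun h' => h'.swap hX h.reflect⟩

/-- `p` is a path from `v` to the first entry of the list `p`. -/
def IsPathFrom (X : CubeComplex V) (v : V) : List V → Prop
  | [] => False
  | [x] => x = v
  | y :: x :: p => X.graph.Adj x y ∧ IsPathFrom X v (x :: p)

lemma SwapEquiv.isPathFrom_iff {v : V} {p q : List V} (h : X.SwapEquiv p q) :
    X.IsPathFrom v p ↔ X.IsPathFrom v q := by
  induction h with
  | refl p => rfl
  | symm h ih => exact ih.symm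
  | trans h h' ih ih' => exact ih.trans ih'
  | @cons z p q h ih =>
    cases p with
    | nil =>
      obtain rfl := List.eq_nil_of_length_eq_zero h.length_eq.symm
      rfl
    | cons a p =>
      cases q with
      | nil => simpa using h.length_eq
      | cons b q =>
        obtain rfl := h.head_eq
        simp only [IsPathFrom, ih]
  | swap h l =>
    obtain ⟨-, -, -, h1, h2, h3, h4⟩ := h
    simp only [IsPathFrom, h1.symm, h2.symm, h3.symm, h4.symm]

lemma IsPathFrom.dist_lt (hX : X.graph.Connected) {v : V} :
    ∀ {p : List V} {x : V}, X.IsPathFrom v (x :: p) → X.graph.dist v x ≤ p.length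
  | [], x, h => by
    obtain rfl : x = v := h
    simp
  | y :: p, x, h => by
    have h1 := IsPathFrom.dist_lt hX h.2
    have h2 := hX.dist_triangle (u := v) (v := y) (w := x)
    rw [SimpleGraph.dist_eq_one_iff_adj.2 h.1] at h2
    simp only [List.length_cons]
    omega

open Classical in
/-- Follow the edge to `z` from the end of the path `p`, cancelling a backtrack. -/
noncomputable def extend (X : CubeComplex V) (p : List V) (z : V) : List V :=
  if h : X.CanPop p z then z :: h.choose_spec.choose else z :: p

lemma extend_of_not_canPop {p : List V} {z : V} (h : ¬ X.CanPop p z) :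
    X.extend p z = z :: p := by
  simp [extend, h]

/-- Makes `extend` independent of its choice of representative, since paths with the same last edge
have equivalent tails. -/
lemma swapEquiv_extend (hX : X.IsCAT0) {p m : List V} {y z : V}
    (h : X.SwapEquiv p (y :: z :: m)) : X.SwapEquiv (X.extend p z) (z :: m) := by
  have hp : X.CanPop p z := ⟨y, m, h⟩
  have key : ∀ y' m', X.SwapEquiv (y :: z :: m) (y' :: z :: m') →
      X.SwapEquiv (z :: m') (z :: m) := by
    intro y' m' h'
    obtain rfl := h'.head_eq
    exact (h'.tail hX).symm
  rw [extend, dif_pos hp]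
  exact key _ _ (h.symm.trans hp.choose_spec.choose_spec)

lemma SwapEquiv.extend (hX : X.IsCAT0) {p q : List V} (h : X.SwapEquiv p q) (z : V) :
    X.SwapEquiv (X.extend p z) (X.extend q z) := by
  by_cases hp : X.CanPop p z
  · obtain ⟨y, m, hy⟩ := hp
    exact (swapEquiv_extend hX hy).trans (swapEquiv_extend hX (h.symm.trans hy)).symm
  · rw [extend_of_not_canPop hp, extend_of_not_canPop ((h.canPop_iff z).not.1 hp)]
    exact h.cons z

/-- A path from `v` to `x` without backtracks, even up to pushing across squares. -/
structure IsReducedPath (X : CubeComplex V) (v x : V) (p : List V) : Prop where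
  head?_eq : p.head? = some x
  reduced : X.Reduced p
  isPathFrom : X.IsPathFrom v p

lemma isReducedPath_singleton (v : V) : X.IsReducedPath v v [v] := by
  refine ⟨rfl, ⟨trivial, ?_⟩, rfl⟩
  rintro ⟨y, m, h⟩
  simpa using h.length_eq

lemma IsReducedPath.exists_eq_cons {v x : V} {p : List V} (h : X.IsReducedPath v x p) :
    ∃ l, p = x :: l := by
  have := h.head?_eq
  cases p with
  | nil => simp at this
  | cons a l => simp at this; exact ⟨l, by rw [this]⟩

lemma SwapEquiv.isReducedPath (hX : X.IsCAT0) {v x : V} {p q : List V} (h : X.SwapEquiv p q)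
    (hp : X.IsReducedPath v x p) : X.IsReducedPath v x q :=
  ⟨h.head?_eq ▸ hp.head?_eq, (h.reduced_iff hX).1 hp.reduced, h.isPathFrom_iff.1 hp.isPathFrom⟩

lemma IsReducedPath.of_cons_cons {v x y : V} {m : List V}
    (h : X.IsReducedPath v x (x :: y :: m)) : X.IsReducedPath v y (y :: m) :=
  ⟨rfl, h.reduced.1, h.isPathFrom.2⟩

/-- Either the last edge can be removed or the path gets longer. -/
lemma IsReducedPath.extend_cases (hX : X.IsCAT0) {v x : V} {p : List V}
    (h : X.IsReducedPath v x p) (y : V) :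
    (∃ m, X.SwapEquiv p (x :: y :: m) ∧ X.SwapEquiv (X.extend p y) (y :: m)) ∨
      (¬ X.CanPop p y ∧ X.extend p y = y :: p) := by
  by_cases hp : X.CanPop p y
  · obtain ⟨a, m, hm⟩ := hp
    obtain ⟨l, rfl⟩ := h.exists_eq_cons
    obtain rfl := hm.head_eq
    exact Or.inl ⟨m, hm, swapEquiv_extend hX hm⟩
  · exact Or.inr ⟨hp, extend_of_not_canPop hp⟩

lemma IsReducedPath.extend (hX : X.IsCAT0) {v x y : V} {p : List V}
    (h : X.IsReducedPath v x p) (hxy : X.graph.Adj x y) :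
    X.IsReducedPath v y (X.extend p y) := by
  rcases h.extend_cases hX y with ⟨m, h1, h2⟩ | ⟨h1, h2⟩
  · exact h2.symm.isReducedPath hX (h1.isReducedPath hX h).of_cons_cons
  · rw [h2]
    refine ⟨rfl, ⟨h.reduced, h1⟩, ?_⟩
    obtain ⟨l, rfl⟩ := h.exists_eq_cons
    exact ⟨hxy, h.isPathFrom⟩

/-- The action of edges on swap classes respects backtracks; `IsReducedPath.extend_square` is the
analogue for squares, so homotopic walks act alike. -/
lemma IsReducedPath.extend_extend (hX : X.IsCAT0) {v x y : V} {p : List V}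
    (h : X.IsReducedPath v x p) : X.SwapEquiv (X.extend (X.extend p y) x) p := by
  rcases h.extend_cases hX y with ⟨m, h1, h2⟩ | ⟨h1, h2⟩
  · refine (h2.extend hX x).trans ?_
    rw [extend_of_not_canPop ((h1.isReducedPath hX h).reduced.2)]
    exact h1.symm
  · rw [h2]
    obtain ⟨l, rfl⟩ := h.exists_eq_cons
    exact swapEquiv_extend hX (.refl _)

lemma IsReducedPath.extend_square (hX : X.IsCAT0) {v x a y b : V} {p : List V}
    (hs : X.IsSquare x a y b) (h : X.IsReducedPath v x p) :
    X.SwapEquiv (X.extend (X.extend p a) y) (X.extend (X.extend p b) y) := by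
  -- The edge to `a` cancels while the edge to `b` lengthens the path; then the second edge
  -- lengthens on the first side and cancels on the other.
  have mixed : ∀ {a b : V}, X.IsSquare x a y b → ∀ {m : List V}, X.SwapEquiv p (x :: a :: m) →
      X.SwapEquiv (X.extend p a) (a :: m) → ¬ X.CanPop p b → X.extend p b = b :: p →
      X.SwapEquiv (X.extend (X.extend p a) y) (X.extend (X.extend p b) y) := by
    intro a b hs m h1 h2 h3 h4
    rw [h4]
    have h5 : ¬ X.CanPop (a :: m) y := by
      rintro ⟨c, r, hr⟩
      obtain rfl := hr.head_eq
      exact h3 ⟨x, y :: r, (h1.trans (hr.cons x)).trans (.swap hs r)⟩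
    refine (h2.extend hX y).trans ?_
    rw [extend_of_not_canPop h5]
    exact (swapEquiv_extend hX ((h1.cons b).trans (.swap hs.rotate.rotate.rotate m))).symm
  rcases h.extend_cases hX a with ⟨m, h1, h2⟩ | ⟨h1, h2⟩
  · rcases h.extend_cases hX b with ⟨m', h1', h2'⟩ | ⟨h1', h2'⟩
    · obtain ⟨w, r, hw, h3, h4⟩ := (h1.symm.trans h1').exists_square hX hs.2.2.1
      obtain rfl := hs.unique hw
      exact ((h2.trans h3).extend hX y).trans <| (swapEquiv_extend hX (.refl _)).trans <|
        ((((h2'.trans h4).extend hX y).trans (swapEquiv_extend hX (.refl _)))).symm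
    · exact mixed hs h1 h2 h1' h2'
  · rcases h.extend_cases hX b with ⟨m', h1', h2'⟩ | ⟨h1', h2'⟩
    · exact (mixed hs.reflect h1' h2' h1 h2).symm
    · rw [h2, h2']
      -- If both first edges lengthen, so do both second ones: a cancellation of `y` after `a` would
      -- use this square and make `b` poppable from `p`.
      have key : ∀ {a b : V}, X.IsSquare x a y b → ¬ X.CanPop p b → ¬ X.CanPop (a :: p) y := by
        rintro a b hs hb ⟨c, r, hr⟩
        obtain ⟨l, rfl⟩ := h.exists_eq_cons
        obtain rfl := hr.head_eq
        obtain ⟨w, s, hw, h3, h4⟩ := hr.exists_square hX hs.2.1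
        obtain rfl := hw.unique hs.rotate.reflect
        exact hb ⟨x, s, h3⟩
      rw [extend_of_not_canPop (key hs h1'), extend_of_not_canPop (key hs.reflect h1)]
      obtain ⟨l, rfl⟩ := h.exists_eq_cons
      exact .swap hs.rotate.rotate.reflect l

/-! ### Homotopy invariance and geodesics. -/

/-- Extend the path `p` by a walk, cancelling backtracks. -/
noncomputable def extendWalk (X : CubeComplex V) :
    ∀ {x y : V}, List V → X.graph.Walk x y → List V
  | _, _, p, .nil => p
  | _, _, p, .cons (v := z) _ w => extendWalk X (X.extend p z) w

lemma SwapEquiv.extendWalk (hX : X.IsCAT0) {x y : V} (w : X.graph.Walk x y) {p q : List V}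
    (h : X.SwapEquiv p q) : X.SwapEquiv (X.extendWalk p w) (X.extendWalk q w) := by
  induction w generalizing p q with
  | nil => exact h
  | cons _ w ih => exact ih (h.extend hX _)

lemma IsReducedPath.extendWalk (hX : X.IsCAT0) {v x y : V} (w : X.graph.Walk x y) {p : List V}
    (h : X.IsReducedPath v x p) : X.IsReducedPath v y (X.extendWalk p w) ∧
      (X.extendWalk p w).length ≤ p.length + w.length := by
  induction w generalizing p with
  | nil => exact ⟨h, le_rfl⟩
  | @cons a b c hab w ih =>
    obtain ⟨h1, h2⟩ := ih (h.extend hX hab)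
    refine ⟨h1, h2.trans ?_⟩
    have : (X.extend p b).length ≤ p.length + 1 := by
      rcases h.extend_cases hX b with ⟨m, h1, h2⟩ | ⟨h1, h2⟩
      · rw [h2.length_eq, h1.length_eq]; simp
      · simp [h2]
    simp only [SimpleGraph.Walk.length_cons]
    omega

lemma Homotopic.extendWalk (hX : X.IsCAT0) {v x y : V} {w w' : X.graph.Walk x y}
    (hw : X.Homotopic w w') {p : List V} (h : X.IsReducedPath v x p) :
    X.SwapEquiv (X.extendWalk p w) (X.extendWalk p w') := by
  induction hw generalizing p with
  | refl w => exact .refl _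
  | symm _ ih => exact (ih h).symm
  | trans _ _ ih ih' => exact (ih h).trans (ih' h)
  | cons hadj _ ih => exact ih (h.extend hX hadj)
  | backtrack hadj w => exact SwapEquiv.extendWalk hX w (h.extend_extend hX)
  | square hs _ _ _ _ w => exact SwapEquiv.extendWalk hX w (h.extend_square hX hs)

lemma Homotopic.append_right {x y z : V} {p q : X.graph.Walk x y} (h : X.Homotopic p q)
    (r : X.graph.Walk y z) : X.Homotopic (p.append r) (q.append r) := by
  induction h with
  | refl p => exact .refl _
  | symm _ ih => exact (ih r).symm
  | trans _ _ ih ih' => exact (ih r).trans (ih' r)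
  | cons hadj _ ih => exact .cons hadj (ih r)
  | backtrack hadj w => exact .backtrack hadj _
  | square hs h1 h2 h3 h4 w => exact .square hs h1 h2 h3 h4 _

lemma Homotopic.append_left {x y z : V} (r : X.graph.Walk x y) {p q : X.graph.Walk y z}
    (h : X.Homotopic p q) : X.Homotopic (r.append p) (r.append q) := by
  induction r with
  | nil => exact h
  | cons hadj r ih => exact .cons hadj (ih h)

lemma IsCAT0.homotopic (hX : X.IsCAT0) {x y : V} (p q : X.graph.Walk x y) :
    X.Homotopic p q := by
  have h1 := (hX.2.2 y (q.reverse.append p)).append_left q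
  rw [SimpleGraph.Walk.append_nil, SimpleGraph.Walk.append_assoc] at h1
  have h2 := (hX.2.2 x (q.append q.reverse)).append_right p
  exact h2.symm.trans h1

/-- In a CAT(0) cube complex all reduced paths between two vertices are geodesics that differ by
pushing across squares. -/
lemma IsCAT0.exists_reduced_geodesic (hX : X.IsCAT0) (v x : V) :
    ∃ p, X.IsReducedPath v x p ∧ p.length = X.graph.dist v x + 1 ∧
      ∀ w : X.graph.Walk v x, X.SwapEquiv (X.extendWalk [v] w) p := by
  obtain ⟨w, hw⟩ := hX.2.1.exists_walk_length_eq_dist v x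
  have hv := isReducedPath_singleton (X := X) v
  obtain ⟨h1, h2⟩ := hv.extendWalk hX w
  refine ⟨_, h1, le_antisymm ?_ ?_, fun w' => (hX.homotopic w' w).extendWalk hX hv⟩
  · rw [← hw, add_comm]; exact h2
  · obtain ⟨l, hl⟩ := h1.exists_eq_cons
    rw [hl] at h1 ⊢
    have := h1.isPathFrom.dist_lt hX.2.1
    simpa using this

lemma extendWalk_append {x y z : V} (p : List V) (w : X.graph.Walk x y) (w' : X.graph.Walk y z) :
    X.extendWalk p (w.append w') = X.extendWalk (X.extendWalk p w) w' := by
  induction w generalizing p with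
  | nil => rfl
  | cons _ w ih => exact ih _ w'

/-! ### Distances, and half-spaces as metric sides of edges. -/

section Metric

variable (hX : X.IsCAT0)
include hX

/-- Extending a reduced path by an edge removes or adds exactly one edge, and reduced paths are
geodesics. -/
lemma IsCAT0.dist_eq_or (v : V) {y z : V} (h : X.graph.Adj y z) :
    X.graph.dist v z = X.graph.dist v y + 1 ∨ X.graph.dist v y = X.graph.dist v z + 1 := by
  obtain ⟨p, h1, h2, h3⟩ := hX.exists_reduced_geodesic v y
  obtain ⟨q, h1', h2', h3'⟩ := hX.exists_reduced_geodesic v z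
  obtain ⟨w⟩ := hX.2.1.preconnected v y
  have h4 := h3' (w.append (.cons h .nil))
  rw [extendWalk_append] at h4
  have h5 := (((h3 w).extend hX z).symm.trans h4).length_eq
  rcases h1.extend_cases hX z with ⟨m, h6, h7⟩ | ⟨h6, h7⟩
  · have := h6.length_eq
    have := h7.length_eq
    simp only [List.length_cons] at *
    omega
  · rw [h7] at h5
    simp only [List.length_cons] at *
    omega

/-- The reduced path to `z` can be swapped to arrive through `y` or through `y'`; comparing these
two forms produces the square. -/
lemma IsCAT0.quadrangle (v : V) {z y y' : V} (h : X.graph.Adj y z) (h' : X.graph.Adj y' z)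
    (hne : y ≠ y') (hd : X.graph.dist v y + 1 = X.graph.dist v z)
    (hd' : X.graph.dist v y' + 1 = X.graph.dist v z) :
    ∃ x, X.IsSquare z y x y' ∧ X.graph.dist v x + 2 = X.graph.dist v z := by
  obtain ⟨q, h1, h2, h3⟩ := hX.exists_reduced_geodesic v z
  have key : ∀ {y : V}, X.graph.Adj y z → X.graph.dist v y + 1 = X.graph.dist v z →
      ∃ m, X.SwapEquiv q (z :: y :: m) := by
    intro y h hd
    obtain ⟨p, h1', h2', h3'⟩ := hX.exists_reduced_geodesic v y
    obtain ⟨w⟩ := hX.2.1.preconnected v z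
    have h4 := h3' (w.append (.cons h.symm .nil))
    rw [extendWalk_append] at h4
    have h5 := (((h3 w).extend hX y).symm.trans h4).length_eq
    rcases h1.extend_cases hX y with ⟨m, h6, h7⟩ | ⟨h6, h7⟩
    · exact ⟨m, h6⟩
    · rw [h7] at h5
      simp only [List.length_cons] at *
      omega
  obtain ⟨m, hm⟩ := key h hd
  obtain ⟨m', hm'⟩ := key h' hd'
  obtain ⟨x, r, hs, h4, -⟩ := (hm.symm.trans hm').exists_square hX hne
  refine ⟨x, hs, ?_⟩
  have h5 := (h4.isReducedPath hX (hm.isReducedPath hX h1).of_cons_cons).of_cons_cons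
  have h6 := h5.isPathFrom.dist_lt hX.2.1
  have h7 := hm.length_eq
  have h8 := h4.length_eq
  simp only [List.length_cons] at h7 h8
  rcases hX.dist_eq_or v hs.2.2.2.2.1 with h | h <;> omega

lemma IsCAT0.isSquare_of_adj {a b c d : V} (hab : X.graph.Adj a b) (hbc : X.graph.Adj b c)
    (had : X.graph.Adj a d) (hdc : X.graph.Adj d c) (hac : a ≠ c) (hbd : b ≠ d) :
    X.IsSquare a b c d := by
  have hb : X.graph.dist c b = 1 := SimpleGraph.dist_eq_one_iff_adj.2 hbc.symm
  have hd : X.graph.dist c d = 1 := SimpleGraph.dist_eq_one_iff_adj.2 hdc.symm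
  have ha : X.graph.dist c a = 2 := by
    have := hX.2.1.pos_dist_of_ne hac.symm
    rcases hX.dist_eq_or c hab with h | h <;> omega
  obtain ⟨x, hs, hx⟩ := hX.quadrangle c hab.symm had.symm hbd (by omega) (by omega)
  have : x = c := ((hX.2.1.dist_eq_zero_iff).1 (by omega)).symm
  rwa [this] at hs

omit hX in
/-- The vertices that are closer to `a` than to `b`. -/
def side (X : CubeComplex V) (a b : V) : Set V :=
  {v | X.graph.dist v a < X.graph.dist v b}

omit hX in
lemma mem_side {a b v : V} : v ∈ X.side a b ↔ X.graph.dist v a < X.graph.dist v b := Iff.rfl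

omit hX in
lemma left_mem_side {a b : V} (h : X.graph.Adj a b) : a ∈ X.side a b := by
  rw [mem_side, SimpleGraph.dist_self, SimpleGraph.dist_eq_one_iff_adj.2 h]
  exact one_pos

omit hX in
lemma right_notMem_side {a b : V} : b ∉ X.side a b := by
  simp [mem_side]

lemma IsCAT0.compl_side {a b : V} (h : X.graph.Adj a b) : (X.side a b)ᶜ = X.side b a := by
  ext v
  rw [Set.mem_compl_iff, mem_side, mem_side]
  rcases hX.dist_eq_or v h with h | h <;> omega

/-- Otherwise `a` and `c` are both one closer to `v` than `b` and `d` are. The quadrangle condition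
at `b` then gives a square whose fourth corner is closer still, yet by uniqueness that corner is
`d`. -/
lemma IsCAT0.side_subset_of_isSquare {a b c d : V} (h : X.IsSquare a b c d) :
    X.side a b ⊆ X.side d c := by
  intro v hv
  by_contra hv'
  obtain ⟨-, h1, h2, h3, h4, h5, h6⟩ := id h
  rw [mem_side] at hv hv'
  have e1 := hX.dist_eq_or v h3
  have e2 := hX.dist_eq_or v h4
  have e3 := hX.dist_eq_or v h5
  have e4 := hX.dist_eq_or v h6
  obtain ⟨x, hs, hx⟩ := hX.quadrangle v h3 h4.symm h1 (by omega) (by omega)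
  obtain rfl := hs.unique h.rotate.reflect
  omega

lemma IsCAT0.side_eq_of_isSquare {a b c d : V} (h : X.IsSquare a b c d) :
    X.side a b = X.side d c :=
  (hX.side_subset_of_isSquare h).antisymm
    (hX.side_subset_of_isSquare h.rotate.rotate.rotate.reflect)

omit hX in
/-- The two sides of an edge. -/
def sides (X : CubeComplex V) : Sym2 V → Set (Set V) :=
  Sym2.lift ⟨fun a b => {X.side a b, X.side b a}, fun _ _ => Set.pair_comm _ _⟩

lemma IsCAT0.sides_eq {e f : Sym2 V} (h : f ∈ X.hyperplane e) : X.sides e = X.sides f := by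
  change Relation.EqvGen _ _ _ at h
  induction h with
  | rel e f h =>
    obtain ⟨a, b, c, d, hs, rfl, rfl⟩ := h
    change ({X.side a b, X.side b a} : Set (Set V)) = {X.side d c, X.side c d}
    rw [hX.side_eq_of_isSquare hs, hX.side_eq_of_isSquare hs.reflect.rotate.rotate.rotate]
  | refl => rfl
  | symm _ _ _ ih => exact ih.symm
  | trans _ _ _ _ _ ih ih' => exact ih.trans ih'

omit hX in
lemma exists_adj_dist (hc : X.graph.Connected) {x y : V} (h : x ≠ y) :
    ∃ z, X.graph.Adj x z ∧ X.graph.dist z y + 1 = X.graph.dist x y := by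
  obtain ⟨w, hw⟩ := hc.exists_walk_length_eq_dist x y
  cases w with
  | nil => exact absurd rfl h
  | @cons _ z _ hxz w =>
    refine ⟨z, hxz, le_antisymm ?_ ?_⟩
    · rw [← hw, SimpleGraph.Walk.length_cons]
      exact Nat.succ_le_succ (SimpleGraph.dist_le w)
    · have := hc.dist_triangle (u := x) (v := z) (w := y)
      rw [SimpleGraph.dist_eq_one_iff_adj.2 hxz] at this
      omega

/-- An edge that joins the two sides of the edge `ab` is dual to the same hyperplane. -/
lemma IsCAT0.mem_hyperplane {x y : V} (hxy : X.graph.Adj x y) :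
    ∀ (n : ℕ) {a b : V}, X.graph.Adj a b → X.graph.dist x a = n → x ∈ X.side a b →
      y ∉ X.side a b → s(x, y) ∈ X.hyperplane s(a, b) := by
  intro n
  induction n with
  | zero =>
    intro a b hab hxa hx hy
    obtain rfl := hX.2.1.dist_eq_zero_iff.1 hxa
    have h1 := SimpleGraph.dist_eq_one_iff_adj.2 hxy.symm
    rw [mem_side] at hy
    have h2 := hX.dist_eq_or y hab
    have h3 : X.graph.dist y b = 0 := by omega
    rw [hX.2.1.dist_eq_zero_iff.1 h3]
    exact Relation.EqvGen.refl _
  | succ n ih =>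
    intro a b hab hxa hx hy
    rw [mem_side] at hx hy
    have hne : a ≠ x := by rintro rfl; simp at hxa
    obtain ⟨a', haa', ha'⟩ := exists_adj_dist hX.2.1 hne
    rw [SimpleGraph.dist_comm, SimpleGraph.dist_comm (u := a)] at ha'
    have e1 := hX.dist_eq_or a hxy
    have e2 := hX.dist_eq_or b hxy
    have e3 := hX.dist_eq_or a' hxy
    have e4 := hX.dist_eq_or x hab
    have e5 := hX.dist_eq_or y hab
    have e6 := hX.dist_eq_or y haa'
    rw [SimpleGraph.dist_comm (u := a), SimpleGraph.dist_comm (u := a)] at e1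
    rw [SimpleGraph.dist_comm (u := b), SimpleGraph.dist_comm (u := b)] at e2
    rw [SimpleGraph.dist_comm (u := a'), SimpleGraph.dist_comm (u := a')] at e3
    have hba' : b ≠ a' := by rintro rfl; omega
    -- Both `b` and `a'` are one closer to `y` than `a` is, so the edge `ab` can be pushed across a
    -- square towards `x`.
    obtain ⟨b', hs, hb'⟩ := hX.quadrangle y hab.symm haa'.symm hba' (by omega) (by omega)
    have hopp : X.OppositeEdges s(a, b) s(a', b') := ⟨a, b, b', a', hs, rfl, rfl⟩
    have hs' : X.side a b = X.side a' b' := hX.side_eq_of_isSquare hs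
    refine Relation.EqvGen.trans _ _ _ (Relation.EqvGen.rel _ _ hopp) ?_
    exact ih hs.2.2.2.2.2.2 (by omega) (hs' ▸ hx) (hs' ▸ hy)

lemma IsCAT0.side_eq_or {a b x y : V} (h : s(x, y) ∈ X.hyperplane s(a, b)) :
    X.side x y = X.side a b ∨ X.side x y = X.side b a := by
  have : X.side x y ∈ X.sides s(x, y) := Or.inl rfl
  rw [← hX.sides_eq h] at this
  exact this

lemma IsCAT0.side_eq {a b x y : V} (hab : X.graph.Adj a b) (hxy : X.graph.Adj x y)
    (hx : x ∈ X.side a b) (hy : y ∉ X.side a b) : X.side x y = X.side a b := by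
  refine (hX.side_eq_or (hX.mem_hyperplane hxy _ hab rfl hx hy)).resolve_right fun h => ?_
  rw [← hX.compl_side hab] at h
  have := left_mem_side hxy
  rw [h] at this
  exact this hx

lemma IsCAT0.deleteEdges_adj_iff {a b x y : V} (hab : X.graph.Adj a b) :
    (X.graph.deleteEdges (X.hyperplane s(a, b))).Adj x y ↔
      X.graph.Adj x y ∧ (x ∈ X.side a b ↔ y ∈ X.side a b) := by
  rw [SimpleGraph.deleteEdges_adj]
  refine and_congr_right fun hxy => ?_
  constructor
  · intro h
    by_contra hne
    apply h
    by_cases hx : x ∈ X.side a b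
    · exact hX.mem_hyperplane hxy _ hab rfl hx (by tauto)
    · rw [Sym2.eq_swap (a := x)]
      exact hX.mem_hyperplane hxy.symm _ hab rfl (by tauto) hx
  · intro h h'
    have h1 := left_mem_side hxy
    have h2 := right_notMem_side (X := X) (a := x) (b := y)
    rcases hX.side_eq_or h' with e | e
    · rw [e] at h1 h2; tauto
    · rw [e, ← hX.compl_side hab] at h1 h2
      exact h2 fun h3 => h1 (h.2 h3)

lemma IsCAT0.reachable_side {a b : V} (hab : X.graph.Adj a b) :
    ∀ (n : ℕ) {v : V}, X.graph.dist v a = n → v ∈ X.side a b →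
      (X.graph.deleteEdges (X.hyperplane s(a, b))).Reachable v a := by
  intro n
  induction n with
  | zero =>
    intro v hv _
    rw [hX.2.1.dist_eq_zero_iff.1 hv]
  | succ n ih =>
    intro v hv hv'
    have hne : v ≠ a := by rintro rfl; simp at hv
    obtain ⟨z, hvz, hz⟩ := exists_adj_dist hX.2.1 hne
    have hz' : z ∈ X.side a b := by
      rw [mem_side] at hv' ⊢
      have := hX.dist_eq_or b hvz
      rw [SimpleGraph.dist_comm, SimpleGraph.dist_comm (u := b)] at this
      omega
    refine SimpleGraph.Reachable.trans ?_ (ih (by omega) hz')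
    exact ((hX.deleteEdges_adj_iff hab).2 ⟨hvz, by tauto⟩).reachable

lemma IsCAT0.reachable_iff {a b v w : V} (hab : X.graph.Adj a b) :
    (X.graph.deleteEdges (X.hyperplane s(a, b))).Reachable v w ↔
      (v ∈ X.side a b ↔ w ∈ X.side a b) := by
  constructor
  · rintro ⟨p⟩
    induction p with
    | nil => rfl
    | cons h _ ih => exact ((hX.deleteEdges_adj_iff hab).1 h).2.trans ih
  · intro h
    by_cases hv : v ∈ X.side a b
    · exact (hX.reachable_side hab _ rfl hv).trans
        (hX.reachable_side hab _ rfl (h.1 hv)).symm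
    · have hw : w ∉ X.side a b := by tauto
      rw [← Set.mem_compl_iff, hX.compl_side hab] at hv hw
      rw [Sym2.eq_swap]
      exact (hX.reachable_side hab.symm _ rfl hv).trans
        (hX.reachable_side hab.symm _ rfl hw).symm

/-- Deleting a hyperplane leaves each metric side connected and removes exactly the edges between
the sides, so its components are the two sides. -/
lemma IsCAT0.isHalfspace_iff {H : Set V} :
    X.IsHalfspace H ↔ ∃ a b, X.graph.Adj a b ∧ H = X.side a b := by
  constructor
  · rintro ⟨e, he, c, rfl⟩
    induction e with | h a b => ?_
    induction c using SimpleGraph.ConnectedComponent.ind with | h v => ?_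
    rw [SimpleGraph.mem_edgeSet] at he
    by_cases hv : v ∈ X.side a b
    · refine ⟨a, b, he, ?_⟩
      ext w
      rw [SimpleGraph.ConnectedComponent.mem_supp_iff, SimpleGraph.ConnectedComponent.eq,
        hX.reachable_iff he]
      tauto
    · refine ⟨b, a, he.symm, ?_⟩
      ext w
      rw [SimpleGraph.ConnectedComponent.mem_supp_iff, SimpleGraph.ConnectedComponent.eq,
        hX.reachable_iff he, ← hX.compl_side he, Set.mem_compl_iff]
      tauto
  · rintro ⟨a, b, hab, rfl⟩
    refine ⟨s(a, b), hab, SimpleGraph.connectedComponentMk _ a, ?_⟩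
    ext w
    rw [SimpleGraph.ConnectedComponent.mem_supp_iff, SimpleGraph.ConnectedComponent.eq,
      hX.reachable_iff hab]
    have := left_mem_side hab
    tauto

lemma IsCAT0.isHalfspace_compl {H : Set V} (h : X.IsHalfspace H) : X.IsHalfspace Hᶜ := by
  obtain ⟨a, b, hab, rfl⟩ := hX.isHalfspace_iff.1 h
  exact hX.isHalfspace_iff.2 ⟨b, a, hab.symm, hX.compl_side hab⟩

lemma IsCAT0.isHalfspace_eq_side {H : Set V} (h : X.IsHalfspace H) {x y : V}
    (hxy : X.graph.Adj x y) (hx : x ∈ H) (hy : y ∉ H) : H = X.side x y := by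
  obtain ⟨a, b, hab, rfl⟩ := hX.isHalfspace_iff.1 h
  exact (hX.side_eq hab hxy hx hy).symm

lemma IsCAT0.interval_of_adj {x y : V} (hxy : X.graph.Adj x y) :
    X.interval x y = {X.side y x} := by
  ext H
  constructor
  · rintro ⟨h1, h2, h3⟩
    exact hX.isHalfspace_eq_side h1 hxy.symm h2 h3
  · rintro rfl
    exact ⟨hX.isHalfspace_iff.2 ⟨y, x, hxy.symm, rfl⟩, left_mem_side hxy.symm,
      right_notMem_side⟩

/-! ### Convexity, gates, the Helly property and separating half-spaces. -/

omit hX in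
/-- Sets of vertices that contain all geodesics between their elements. -/
def IsGeodConvex (X : CubeComplex V) (S : Set V) : Prop :=
  ∀ ⦃x⦄, x ∈ S → ∀ ⦃y⦄, y ∈ S → ∀ ⦃z⦄,
    X.graph.dist x z + X.graph.dist z y = X.graph.dist x y → z ∈ S

omit hX in
lemma IsGeodConvex.inter {S T : Set V} (hS : X.IsGeodConvex S) (hT : X.IsGeodConvex T) :
    X.IsGeodConvex (S ∩ T) :=
  fun _ hx _ hy _ hz => ⟨hS hx.1 hy.1 hz, hT hx.2 hy.2 hz⟩

/-- If a geodesic towards `y` left `H` along `xw`, then `H` would be the side of `x` against `w`,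
although `y` is closer to `w`. -/
lemma IsCAT0.isGeodConvex {H : Set V} (hH : X.IsHalfspace H) : X.IsGeodConvex H := by
  have key : ∀ (n : ℕ) {x y z : V}, x ∈ H → y ∈ H → X.graph.dist x z = n →
      X.graph.dist x z + X.graph.dist z y = X.graph.dist x y → z ∈ H := by
    intro n
    induction n with
    | zero =>
      intro x y z hx _ hz _
      exact hX.2.1.dist_eq_zero_iff.1 hz ▸ hx
    | succ n ih =>
      intro x y z hx hy hz hxyz
      have hne : x ≠ z := by rintro rfl; simp at hz
      obtain ⟨w, hxw, hw⟩ := exists_adj_dist hX.2.1 hne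
      have e1 := hX.2.1.dist_triangle (u := w) (v := z) (w := y)
      have e2 := hX.2.1.dist_triangle (u := x) (v := w) (w := y)
      rw [SimpleGraph.dist_eq_one_iff_adj.2 hxw] at e2
      refine ih ?_ hy (by omega) (by omega : X.graph.dist w z + X.graph.dist z y = _)
      by_contra hwH
      rw [hX.isHalfspace_eq_side hH hxw hx hwH, mem_side, SimpleGraph.dist_comm,
        SimpleGraph.dist_comm (u := y)] at hy
      omega
  exact fun x hx y hy z hz => key _ hx hy rfl hz

/-- Convex sets are gated. -/
lemma IsCAT0.exists_gate {S : Set V} (hS : X.IsGeodConvex S) (hne : S.Nonempty) (v : V) :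
    ∃ w ∈ S, ∀ u ∈ S, X.graph.dist v w + X.graph.dist w u = X.graph.dist v u := by
  obtain ⟨w, hw, hmin⟩ := exists_minimalFor_of_wellFoundedLT (· ∈ S) (X.graph.dist v) hne
  replace hmin : ∀ u ∈ S, X.graph.dist v w ≤ X.graph.dist v u := fun u hu =>
    (le_total _ _).elim id fun h => hmin hu h
  refine ⟨w, hw, ?_⟩
  have key : ∀ (n : ℕ) (u : V), u ∈ S → X.graph.dist u w = n →
      X.graph.dist v w + X.graph.dist u w = X.graph.dist v u := by
    intro n
    induction n using Nat.strong_induction_on with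
    | _ n ih =>
      intro u hu hn
      by_cases huw : u = w
      · subst huw; simp
      obtain ⟨u₁, hu₁, hd₁⟩ := exists_adj_dist hX.2.1 huw
      have d1 := SimpleGraph.dist_eq_one_iff_adj.2 hu₁
      have hu₁S : u₁ ∈ S := hS hu hw (by omega)
      have i1 := ih _ (by omega) u₁ hu₁S rfl
      -- In the first case `u` and the vertex `u₂` after `u₁` are both closer to `v` than `u₁` is.
      -- Quadrangle and convexity give `x ∈ S` with `x` too close to `v` for the gate identity
      -- already known for it.
      rcases hX.dist_eq_or v hu₁ with e | e
      · by_cases huw₁ : u₁ = w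
        · subst huw₁
          have := hmin u hu
          omega
        obtain ⟨u₂, hu₂, hd₂⟩ := exists_adj_dist hX.2.1 huw₁
        have d2 := SimpleGraph.dist_eq_one_iff_adj.2 hu₂
        have hu₂S : u₂ ∈ S := hS hu₁S hw (by omega)
        have i2 := ih _ (by omega) u₂ hu₂S rfl
        have hne : u ≠ u₂ := by rintro rfl; omega
        obtain ⟨x, hs, hx⟩ := hX.quadrangle v hu₁ hu₂.symm hne (by omega) (by omega)
        have e3 := hX.dist_eq_or w hs.2.2.2.2.2.2
        have e4 := hX.dist_eq_or w hs.2.2.2.2.1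
        rw [SimpleGraph.dist_comm, SimpleGraph.dist_comm (u := w)] at e3 e4
        have h2 : X.graph.dist u u₂ = 2 := by
          have t1 := hX.2.1.dist_triangle (u := u) (v := u₂) (w := w)
          have t2 := hX.2.1.dist_triangle (u := u) (v := u₁) (w := u₂)
          omega
        have hxS : x ∈ S := by
          apply hS hu hu₂S
          rw [SimpleGraph.dist_eq_one_iff_adj.2 hs.2.2.2.2.1, SimpleGraph.dist_comm,
            SimpleGraph.dist_eq_one_iff_adj.2 hs.2.2.2.2.2.2, h2]
        have i3 := ih _ (by omega) x hxS rfl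
        omega
      · omega
  intro u hu
  rw [SimpleGraph.dist_comm (u := w)]
  exact key _ u hu rfl

/-- The Helly property for three convex sets. -/
lemma IsCAT0.helly {A B C : Set V} (hA : X.IsGeodConvex A) (hB : X.IsGeodConvex B)
    (hC : X.IsGeodConvex C) (hAB : (A ∩ B).Nonempty) (hAC : (A ∩ C).Nonempty)
    (hBC : (B ∩ C).Nonempty) : (A ∩ B ∩ C).Nonempty := by
  obtain ⟨v, hvA, hvB⟩ := hAB
  obtain ⟨u, huA, huC⟩ := hAC
  obtain ⟨u', huB, huC'⟩ := hBC
  -- The gate in `C` of a point of `A ∩ B` lies on geodesics to points of `A ∩ C` and of `B ∩ C`.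
  obtain ⟨w, hw, hgate⟩ := hX.exists_gate hC ⟨u, huC⟩ v
  exact ⟨w, ⟨hA hvA huA (hgate u huC), hB hvB huB (hgate u' huC')⟩, hw⟩

/-- The extra convex set `D` lets the induction absorb one `f j` at a time; pairwise intersections
survive by `helly`. -/
lemma IsCAT0.helly_finset {ι : Type*} (s : Finset ι) {f : ι → Set V}
    (hf : ∀ i ∈ s, X.IsGeodConvex (f i)) (hff : ∀ i ∈ s, ∀ j ∈ s, (f i ∩ f j).Nonempty) :
    ∀ {D : Set V}, X.IsGeodConvex D → D.Nonempty → (∀ i ∈ s, (D ∩ f i).Nonempty) →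
      (D ∩ ⋂ i ∈ s, f i).Nonempty := by
  classical
  induction s using Finset.induction with
  | empty => intro D _ hD _; simpa using hD
  | insert j s hj ih =>
    intro D hD _ hDf
    have hj' := Finset.mem_insert_self j s
    have hs : ∀ i ∈ s, i ∈ insert j s := fun i hi => Finset.mem_insert_of_mem hi
    have := ih (fun i hi => hf i (hs i hi))
      (fun i hi k hk => hff i (hs i hi) k (hs k hk)) (hD.inter (hf j hj')) (hDf j hj')
      (fun i hi => hX.helly hD (hf j hj') (hf i (hs i hi)) (hDf j hj') (hDf i (hs i hi))
        (hff j hj' i (hs i hi)))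
    rwa [Finset.set_biInter_insert, ← Set.inter_assoc]

omit hX in
lemma interval_subset_union (x y z : V) : X.interval x z ⊆ X.interval x y ∪ X.interval y z := by
  rintro H ⟨h1, h2, h3⟩
  by_cases hy : y ∈ H
  · exact Or.inl ⟨h1, hy, h3⟩
  · exact Or.inr ⟨h1, h2, hy⟩

lemma IsCAT0.finite_interval (x y : V) : (X.interval x y).Finite := by
  obtain ⟨p⟩ := hX.2.1.preconnected x y
  induction p with
  | nil => exact Set.Finite.subset Set.finite_empty fun H h => h.2.2 h.2.1
  | cons h _ ih =>
    refine Set.Finite.subset (Set.Finite.union ?_ ih) (interval_subset_union _ _ _)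
    rw [hX.interval_of_adj h]
    exact Set.finite_singleton _

/-- Each edge of a geodesic from `x` to `y` contributes a new half-space of the interval. -/
lemma IsCAT0.dist_le_ncard_interval (x y : V) :
    X.graph.dist x y ≤ (X.interval x y).ncard := by
  have key : ∀ (n : ℕ) {x : V}, X.graph.dist x y = n → n ≤ (X.interval x y).ncard := by
    intro n
    induction n with
    | zero => intros; exact Nat.zero_le _
    | succ n ih =>
      intro x hn
      have hne : x ≠ y := by rintro rfl; simp at hn
      obtain ⟨z, hxz, hz⟩ := exists_adj_dist hX.2.1 hne
      have h1 := ih (x := z) (by omega)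
      have h2 : X.side z x ∉ X.interval z y := fun h => h.2.2 (left_mem_side hxz.symm)
      have h3 : insert (X.side z x) (X.interval z y) ⊆ X.interval x y := by
        rintro H (rfl | ⟨hH, hy, hzH⟩)
        · refine ⟨hX.isHalfspace_iff.2 ⟨z, x, hxz.symm, rfl⟩, ?_, right_notMem_side⟩
          rw [mem_side, SimpleGraph.dist_comm, SimpleGraph.dist_comm (u := y)]
          omega
        · refine ⟨hH, hy, fun hx => hzH (hX.isGeodConvex hH hx hy ?_)⟩
          rw [SimpleGraph.dist_eq_one_iff_adj.2 hxz]
          omega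
      have h4 := Set.ncard_le_ncard h3 (hX.finite_interval x y)
      rw [Set.ncard_insert_of_notMem h2 (hX.finite_interval z y)] at h4
      omega
  exact key _ rfl

lemma IsCAT0.adj_of_interval_subset {x y : V} {H : Set V} (h : x ≠ y)
    (hH : X.interval x y ⊆ {H}) : X.graph.Adj x y := by
  rw [← SimpleGraph.dist_eq_one_iff_adj]
  have h1 := hX.dist_le_ncard_interval x y
  have h2 := Set.ncard_le_ncard hH (Set.finite_singleton H)
  rw [Set.ncard_singleton] at h2
  have := hX.2.1.pos_dist_of_ne h
  omega

end Metric

/-! ### Cubes recovered from their `1`-skeleta. -/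

/-- The `1`-skeleton of a combinatorial cube in `X`. -/
structure IsCubeMap (X : CubeComplex V) {n : ℕ} (p : (Fin n → Bool) → V) : Prop where
  injective : Function.Injective p
  adj : ∀ a i, X.graph.Adj (p a) (p (flipCoord a i))

lemma IsChart.isCubeMap {n : ℕ} {φ : (Fin n → Bool) → V} (h : X.IsChart φ) : X.IsCubeMap φ :=
  ⟨h.injective, h.adj⟩

namespace IsCubeMap

variable {n : ℕ} {p q : (Fin n → Bool) → V}

lemma isSquare (hX : X.IsCAT0) (hp : X.IsCubeMap p) (a : Fin n → Bool) {i j : Fin n}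
    (hij : i ≠ j) : X.IsSquare (p a) (p (flipCoord a i)) (p (flipCoord (flipCoord a i) j))
      (p (flipCoord a j)) := by
  refine hX.isSquare_of_adj (hp.adj _ _) (hp.adj _ _) (hp.adj _ _) ?_
    (fun e => flipCoord_flipCoord_ne a hij (hp.injective e).symm)
    (fun e => hij (flipCoord_injective a (hp.injective e)))
  rw [flipCoord_comm]
  exact hp.adj _ _

/-- The `1`-skeleton of a cube is determined by one of its corners. -/
lemma ext (hX : X.IsCAT0) (hp : X.IsCubeMap p) (hq : X.IsCubeMap q) (o : Fin n → Bool)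
    (ho : p o = q o) (hoi : ∀ i, p (flipCoord o i) = q (flipCoord o i)) : p = q := by
  -- Induction on the Hamming distance to `o`: beyond the neighbours of `o`, the vertex is the
  -- fourth corner of a square whose other corners are closer to `o`.
  have key : ∀ (k : ℕ) (a : Fin n → Bool), (Finset.univ.filter fun i => a i ≠ o i).card = k →
      p a = q a := by
    intro k
    induction k using Nat.strong_induction_on with
    | _ k ih =>
      intro a hk
      have drop : ∀ (b : Fin n → Bool) (i : Fin n), b i ≠ o i →
          (Finset.univ.filter fun j => flipCoord b i j ≠ o j) =
            (Finset.univ.filter fun j => b j ≠ o j).erase i := by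
        intro b i hi
        ext j
        simp only [Finset.mem_filter, Finset.mem_univ, true_and, Finset.mem_erase]
        by_cases hj : j = i
        · subst hj
          rw [flipCoord_same]
          cases h1 : b j <;> cases h2 : o j <;> simp_all
        · rw [flipCoord_of_ne _ hj]; tauto
      have drop' : ∀ (b : Fin n → Bool) (i : Fin n), b i ≠ o i →
          (Finset.univ.filter fun j => flipCoord b i j ≠ o j).card <
            (Finset.univ.filter fun j => b j ≠ o j).card := by
        intro b i hi
        rw [drop b i hi]
        exact Finset.card_erase_lt_of_mem (by simpa using hi)
      by_cases h0 : a = o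
      · rw [h0, ho]
      obtain ⟨i, hi⟩ := Function.ne_iff.1 h0
      by_cases h1 : flipCoord a i = o
      · rw [← flipCoord_flipCoord a i, h1]
        exact hoi i
      obtain ⟨j, hj⟩ := Function.ne_iff.1 h1
      have hji : j ≠ i := by
        rintro rfl
        rw [flipCoord_same] at hj
        cases h2 : a j <;> cases h3 : o j <;> simp_all
      have hj' : a j ≠ o j := by rwa [flipCoord_of_ne _ hji] at hj
      have l1 := drop' a i hi
      have l2 := drop' a j hj'
      have l3 := drop' _ j hj
      have e1 := ih _ (by omega) (flipCoord a i) rfl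
      have e2 := ih _ (by omega) (flipCoord a j) rfl
      have e3 := ih _ (by omega) (flipCoord (flipCoord a i) j) rfl
      have s1 := hp.isSquare hX a hji.symm
      have s2 := hq.isSquare hX a hji.symm
      rw [← e1, ← e2, ← e3] at s2
      exact s1.rotate.rotate.unique s2.rotate.rotate
  exact funext fun a => key _ a rfl

/-- The `1`-skeleton of a cube bounds a cube. -/
lemma range_mem_cubes (hX : X.IsCAT0) (hp : X.IsCubeMap p) : Set.range p ∈ X.cubes := by
  set o : Fin n → Bool := fun _ => false with ho
  have hinj : Function.Injective fun i => p (flipCoord o i) :=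
    hp.injective.comp (flipCoord_injective o)
  obtain ⟨m, φ, o', hφ, hφo, hS⟩ := hX.exists_chart_of_pairwise (v := p o)
    (S := Set.range fun i => p (flipCoord o i)) (Set.finite_range _)
    (by rintro _ ⟨i, rfl⟩; exact hp.adj _ _) (by
      rintro _ ⟨i, rfl⟩ _ ⟨j, rfl⟩ hne
      exact ⟨_, hp.isSquare hX o fun h => hne (by rw [h])⟩)
  have hinj' : Function.Injective fun i => φ (flipCoord o' i) :=
    hφ.injective.comp (flipCoord_injective o')
  let τ : Fin n ≃ Fin m := (Equiv.ofInjective _ hinj).trans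
    ((Equiv.setCongr hS).trans (Equiv.ofInjective _ hinj').symm)
  have hτ : ∀ i, φ (flipCoord o' (τ i)) = p (flipCoord o i) := by
    intro i
    have := Equiv.apply_ofInjective_symm hinj'
      (Equiv.setCongr hS (Equiv.ofInjective _ hinj i))
    exact this
  -- Relabel coordinates by `τ` and translate by xor, so that `o` goes to `o'` and the chart agrees
  -- with `p` at the corner and its neighbours.
  let E : (Fin n → Bool) ≃ (Fin m → Bool) :=
    { toFun := fun a j => xor (o' j) (a (τ.symm j))
      invFun := fun b i => xor (o' (τ i)) (b (τ i))
      left_inv := fun a => by ext i; simp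
      right_inv := fun b => by ext j; simp }
  have hE : ∀ a i, E (flipCoord a i) = flipCoord (E a) (τ i) := by
    intro a i
    ext j
    by_cases hj : j = τ i
    · subst hj
      simp [E]
    · rw [flipCoord_of_ne _ hj]
      have : τ.symm j ≠ i := fun h => hj (by rw [← h]; simp)
      simp only [E, Equiv.coe_fn_mk, flipCoord_of_ne _ this]
  have hEo : E o = o' := by ext j; simp [E, ho]
  have hq : X.IsCubeMap (φ ∘ E) :=
    ⟨hφ.injective.comp E.injective, fun a i => by
      simp only [Function.comp_apply, hE]
      exact hφ.adj _ _⟩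
  have : p = φ ∘ E := hp.ext hX hq o (by simp [hEo, hφo]) fun i => by
    simp only [Function.comp_apply, hE, hEo, hτ]
  rw [this, E.surjective.range_comp]
  exact hφ.range_mem

lemma side_eq (hX : X.IsCAT0) (hp : X.IsCubeMap p) (a b : Fin n → Bool) (i : Fin n) :
    X.side (p (Function.update a i true)) (p (Function.update a i false)) =
      X.side (p (Function.update b i true)) (p (Function.update b i false)) := by
  refine eq_of_forall_flipCoord
    (f := fun a => X.side (p (Function.update a i true)) (p (Function.update a i false)))
    (I := Set.univ) ?_ (by simp)
  rintro a j -
  rcases eq_or_ne j i with rfl | hji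
  · simp [flipCoord]
  · have h := hX.side_eq_of_isSquare (hp.isSquare hX (Function.update a i true) hji.symm)
    have e : ∀ t, Function.update (flipCoord a j) i t = flipCoord (Function.update a i t) j := by
      intro t
      ext k
      by_cases hk : k = i <;> by_cases hk' : k = j <;> simp_all [flipCoord]
    have e' : flipCoord (Function.update a i true) i = Function.update a i false := by
      simp [flipCoord]
    simp only [e]
    rw [e'] at h
    exact h.symm

/-- The half-space dual to the edges in the direction `i`. -/
def dualSide (X : CubeComplex V) (p : (Fin n → Bool) → V) (i : Fin n) : Set V :=
  X.side (p (Function.update (fun _ => false) i true))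
    (p (Function.update (fun _ => false) i false))

lemma mem_dualSide (hX : X.IsCAT0) (hp : X.IsCubeMap p) (a : Fin n → Bool) (i : Fin n) :
    p a ∈ dualSide X p i ↔ a i = true := by
  have hadj : X.graph.Adj (p (Function.update a i true)) (p (Function.update a i false)) := by
    have := hp.adj (Function.update a i true) i
    simpa [flipCoord] using this
  rw [dualSide, hp.side_eq hX _ a]
  cases h : a i
  · rw [show a = Function.update a i false by rw [← h, Function.update_eq_self]]
    simpa using right_notMem_side
  · rw [show a = Function.update a i true by rw [← h, Function.update_eq_self]]
    simpa using left_mem_side hadj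

lemma side_flipCoord (hX : X.IsCAT0) (hp : X.IsCubeMap p) (a : Fin n → Bool) (i : Fin n) :
    X.side (p a) (p (flipCoord a i)) = dualSide X p i ∨
      X.side (p a) (p (flipCoord a i)) = (dualSide X p i)ᶜ := by
  rw [dualSide, hp.side_eq hX _ a]
  have hadj := hp.adj a i
  cases h : a i
  · right
    have e1 : Function.update a i false = a := by rw [← h, Function.update_eq_self]
    have e2 : Function.update a i true = flipCoord a i := by simp [flipCoord, h]
    rw [e1, e2, hX.compl_side hadj.symm]
  · left
    have e1 : Function.update a i true = a := by rw [← h, Function.update_eq_self]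
    have e2 : Function.update a i false = flipCoord a i := by simp [flipCoord, h]
    rw [e1, e2]

end IsCubeMap

/-! ### Projection to the Sageev construction. -/

section Sageev

variable {P : Set (Set V)}

lemma principal_mem_vertices (hP : ∀ H ∈ P, Hᶜ ∈ P) (v : V) :
    Sageev.principal P v ∈ Sageev.vertices P := by
  refine ⟨⟨fun H h => h.1, fun H hH => ?_, fun H hH K hK => ⟨v, hH.2, hK.2⟩⟩, v, by simp⟩
  by_cases hv : v ∈ H
  · exact Or.inl ⟨⟨hH, hv⟩, fun h => h.2 hv⟩
  · exact Or.inr ⟨⟨hP H hH, hv⟩, fun h => hv h.2⟩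

variable (hX : X.IsCAT0) (hPX : ∀ H ∈ P, X.IsHalfspace H)
include hX hPX

lemma IsCAT0.adjacent_principal {x y : V} (hxy : X.graph.Adj x y) (hP : ∀ H ∈ P, Hᶜ ∈ P)
    (hs : X.side x y ∈ P) :
    Sageev.Adjacent (Sageev.principal P x) (Sageev.principal P y) := by
  refine ⟨X.side x y, ⟨hs, left_mem_side hxy⟩, ?_⟩
  have hc := hX.compl_side hxy
  have hs' := hP _ hs
  ext K
  simp only [Set.mem_insert_iff, Set.mem_sdiff, Set.mem_singleton_iff]
  constructor
  · rintro ⟨hK, hy⟩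
    by_cases hx : x ∈ K
    · exact Or.inr ⟨⟨hK, hx⟩, fun h => right_notMem_side (h ▸ hy)⟩
    · exact Or.inl ((hX.isHalfspace_eq_side (hPX K hK) hxy.symm hy hx).trans hc.symm)
  · rintro (rfl | ⟨⟨hK, hx⟩, hne⟩)
    · exact ⟨hs', right_notMem_side⟩
    · refine ⟨hK, ?_⟩
      by_contra hy
      exact hne (hX.isHalfspace_eq_side (hPX K hK) hxy hx hy)

lemma IsCAT0.principal_eq_of_adj {x y : V} (hxy : X.graph.Adj x y)
    (hs : X.side x y ∉ P) (hs' : X.side y x ∉ P) :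
    Sageev.principal P x = Sageev.principal P y := by
  ext K
  refine and_congr_right fun hK => ?_
  by_cases hx : x ∈ K <;> by_cases hy : y ∈ K
  · simp [hx, hy]
  · exact absurd (hX.isHalfspace_eq_side (hPX K hK) hxy hx hy ▸ hK) hs
  · exact absurd (hX.isHalfspace_eq_side (hPX K hK) hxy.symm hy hx ▸ hK) hs'
  · simp [hx, hy]

/-- The projection to the Sageev construction maps cubes to cubes. -/
lemma IsCAT0.image_principal_mem_cubes (hP : ∀ H ∈ P, Hᶜ ∈ P) {C : Set V} (hC : C ∈ X.cubes) :
    Sageev.principal P '' C ∈ Sageev.cubes P := by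
  classical
  obtain ⟨n, φ, hφ, rfl⟩ := exists_isChart hC
  replace hφ := hφ.isCubeMap
  set K := IsCubeMap.dualSide X φ with hK
  have hPc : ∀ H, Hᶜ ∈ P ↔ H ∈ P := fun H => ⟨fun h => compl_compl H ▸ hP _ h, hP H⟩
  have hside : ∀ a i, X.side (φ a) (φ (flipCoord a i)) ∈ P ↔ K i ∈ P := by
    intro a i
    rcases hφ.side_flipCoord hX a i with h | h <;> rw [h]
    exact hPc _
  let e := Fintype.equivFin {i // K i ∈ P}
  -- The projection collapses exactly the directions dual to half-spaces outside `P`; `E` picks the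
  -- slice where those coordinates are `false`.
  let E : (Fin (Fintype.card {i // K i ∈ P}) → Bool) → Fin n → Bool :=
    fun b i => if h : K i ∈ P then b (e ⟨i, h⟩) else false
  have hE : ∀ b m, E b (e.symm m).1 = b m := by
    intro b m
    simp [E, (e.symm m).2]
  have hEf : ∀ b m, E (flipCoord b m) = flipCoord (E b) (e.symm m).1 := by
    intro b m
    ext i
    by_cases hi : i = (e.symm m).1
    · subst hi
      rw [flipCoord_same, hE, hE, flipCoord_same]
    · rw [flipCoord_of_ne _ hi]
      by_cases h : K i ∈ P
      · have : e ⟨i, h⟩ ≠ m := by rintro rfl; simp at hi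
        simp only [E, h, dif_pos, flipCoord_of_ne _ this]
      · simp [E, h]
  refine ⟨_, fun b => Sageev.principal P (φ (E b)), ?_, ?_,
    fun b => principal_mem_vertices hP _, ?_⟩
  · intro b b' hbb
    ext m
    have h1 : K (e.symm m).1 ∈ Sageev.principal P (φ (E b)) ↔
        K (e.symm m).1 ∈ Sageev.principal P (φ (E b')) := by
      have := congrArg (K (e.symm m).1 ∈ ·) hbb
      exact iff_of_eq this
    simp only [Sageev.principal, Set.mem_ofPred_eq, hK, hφ.mem_dualSide hX, hE] at h1
    rw [← hK] at h1
    have h2 := (e.symm m).2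
    simp only [h2, true_and] at h1
    rw [Bool.eq_iff_iff]
    exact h1
  · ext σ
    constructor
    · rintro ⟨b, rfl⟩
      exact ⟨_, ⟨_, rfl⟩, rfl⟩
    · rintro ⟨_, ⟨a, rfl⟩, rfl⟩
      refine ⟨fun m => a (e.symm m).1, ?_⟩
      refine eq_of_forall_flipCoord (f := fun a => Sageev.principal P (φ a))
        (I := {i | K i ∉ P}) ?_ ?_
      · intro a i hi
        have hi' : K i ∉ P := hi
        refine (hX.principal_eq_of_adj hPX (hφ.adj a i) ?_ ?_).symm
        · rwa [hside]
        · rwa [← hX.compl_side (hφ.adj a i), hPc, hside]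
      · intro i hi
        have hi' : K i ∈ P := not_not.1 hi
        simp [E, hi']
  · intro b m
    change Sageev.Adjacent _ (Sageev.principal P (φ (E (flipCoord b m))))
    rw [hEf]
    refine hX.adjacent_principal hPX (hφ.adj _ _) hP ?_
    rw [hside]
    exact (e.symm m).2

end Sageev

open Filter

variable {g : Equiv.Perm V}

/-! ### Automorphisms as isometries. -/

section Isometry

lemma IsAutomorphism.adj_iff (hg : X.IsAutomorphism g) (x y : V) :
    X.graph.Adj (g x) (g y) ↔ X.graph.Adj x y := by
  change (g x ≠ g y ∧ {g x, g y} ∈ X.cubes) ↔ (x ≠ y ∧ {x, y} ∈ X.cubes)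
  rw [← Set.image_pair, hg, g.injective.ne_iff]

lemma IsAutomorphism.dist_eq (hg : X.IsAutomorphism g) (hc : X.graph.Connected) (x y : V) :
    X.graph.dist (g x) (g y) = X.graph.dist x y := by
  let f : X.graph ≃g X.graph := ⟨g, hg.adj_iff _ _⟩
  have key : ∀ (f : X.graph ≃g X.graph) x y, X.graph.dist (f x) (f y) ≤ X.graph.dist x y := by
    intro f x y
    obtain ⟨w, hw⟩ := hc.exists_walk_length_eq_dist x y
    rw [← hw, ← SimpleGraph.Walk.length_map f.toHom w]
    exact SimpleGraph.dist_le (w.map f.toHom)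
  refine (key f x y).antisymm ?_
  have := key f.symm (f x) (f y)
  rwa [f.symm_apply_apply, f.symm_apply_apply] at this

lemma dist_zpow (hd : ∀ x y, X.graph.dist (g x) (g y) = X.graph.dist x y) (n : ℤ) :
    ∀ x y, X.graph.dist ((g ^ n) x) ((g ^ n) y) = X.graph.dist x y := by
  induction n with
  | zero => simp
  | succ n ih =>
    intro x y
    rw [zpow_add_one, Equiv.Perm.mul_apply, Equiv.Perm.mul_apply, ih, hd]
  | pred n ih =>
    intro x y
    rw [zpow_sub_one, Equiv.Perm.mul_apply, Equiv.Perm.mul_apply, ih, ← hd]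
    simp

lemma IsCAT0.isHalfspace_preimage (hX : X.IsCAT0)
    (hd : ∀ x y, X.graph.dist (g x) (g y) = X.graph.dist x y) {H : Set V}
    (hH : X.IsHalfspace H) : X.IsHalfspace (g ⁻¹' H) := by
  obtain ⟨a, b, hab, rfl⟩ := hX.isHalfspace_iff.1 hH
  refine hX.isHalfspace_iff.2 ⟨g.symm a, g.symm b, ?_, ?_⟩
  · rw [← SimpleGraph.dist_eq_one_iff_adj, ← hd]
    simpa using hab
  · ext v
    rw [Set.mem_preimage, mem_side, mem_side, ← hd v, ← hd v]
    simp

lemma IsHyperbolic.dist_eq (hg : X.IsHyperbolic g) (hc : X.graph.Connected) (n : ℤ) (x y : V) :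
    X.graph.dist ((g ^ n) x) ((g ^ n) y) = X.graph.dist x y :=
  dist_zpow (hg.isAutomorphism.dist_eq hc) n x y

lemma IsHyperbolic.isHalfspace_zpow_preimage (hg : X.IsHyperbolic g) (hX : X.IsCAT0) (n : ℤ)
    {H : Set V} (hH : X.IsHalfspace H) : X.IsHalfspace ((g ^ n : Equiv.Perm V) ⁻¹' H) :=
  hX.isHalfspace_preimage (hg.dist_eq hX.2.1 n) hH

end Isometry

/-! ### Dynamics of `g` on the half-space axis. -/

section Axis

variable {γ : ℤ → V}

lemma IsCombinatorialAxis.adj (hγ : X.IsCombinatorialAxis g γ) (i : ℤ) :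
    X.graph.Adj (γ i) (γ (i + 1)) := by
  rw [← SimpleGraph.dist_eq_one_iff_adj, hγ.1]
  simp

lemma IsCombinatorialAxis.zpow_apply (hγ : X.IsCombinatorialAxis g γ) (n i : ℤ) :
    (g ^ n) (γ i) = γ (i + n * X.translationDistance g) := by
  induction n generalizing i with
  | zero => simp
  | succ n ih =>
    rw [zpow_add_one, Equiv.Perm.mul_apply, hγ.2, ih]
    congr 1
    ring
  | pred n ih =>
    have : g⁻¹ (γ i) = γ (i - X.translationDistance g) := by
      rw [Equiv.Perm.inv_eq_iff_eq, hγ.2]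
      simp
    rw [zpow_sub_one, Equiv.Perm.mul_apply, this, ih]
    congr 1
    ring

lemma exists_mem_interval {H : Set V}
    (hH : X.IsHalfspace H) {j k : ℤ} (hjk : j ≤ k) (hj : γ j ∉ H) (hk : γ k ∈ H) :
    ∃ i, H ∈ X.interval (γ i) (γ (i + 1)) := by
  by_contra h
  push Not at h
  have key : ∀ k, j ≤ k → γ k ∉ H := by
    intro k hjk
    induction k, hjk using Int.leInduction with
    | base => exact hj
    | succ k _ ih => exact fun hk => h k ⟨hH, hk, ih⟩
  exact key k hjk hk

variable (hX : X.IsCAT0)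
include hX

/-- An axis is geodesic and both `H` and its complement are convex, so it crosses only once. -/
lemma IsCombinatorialAxis.mem_iff (hγ : X.IsCombinatorialAxis g γ) {H : Set V} {i : ℤ}
    (hH : H ∈ X.interval (γ i) (γ (i + 1))) (j : ℤ) : γ j ∈ H ↔ i < j := by
  obtain ⟨h1, h2, h3⟩ := hH
  constructor
  · intro hj
    by_contra hij
    refine h3 (hX.isGeodConvex h1 hj h2 ?_)
    rw [hγ.1, hγ.1, hγ.1]
    omega
  · intro hij
    by_contra hj
    refine hX.isGeodConvex (hX.isHalfspace_compl h1) h3 hj (z := γ (i + 1)) ?_ h2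
    rw [hγ.1, hγ.1, hγ.1]
    omega

variable (hg : X.IsHyperbolic g)
include hg

/-- The translates of `H` cross the axis at different edges, hence are distinct, and only finitely
many half-spaces separate two vertices. -/
lemma finite_setOf_preimage_mem {H : Set V} (hH : H ∈ X.positiveAxis g) (x y : V) :
    {n : ℤ | (g ^ n : Equiv.Perm V) ⁻¹' H ∈ X.interval x y}.Finite := by
  refine Set.Finite.preimage (f := fun n : ℤ => (g ^ n : Equiv.Perm V) ⁻¹' H) ?_
    (hX.finite_interval x y)
  refine Function.Injective.injOn fun n m hnm => ?_
  obtain ⟨γ, hγ, i, hi⟩ := hH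
  have key : ∀ j, i < j + n * X.translationDistance g ↔ i < j + m * X.translationDistance g := by
    intro j
    rw [← hγ.mem_iff hX hi, ← hγ.mem_iff hX hi, ← hγ.zpow_apply, ← hγ.zpow_apply]
    have := congrArg (γ j ∈ ·) hnm
    exact iff_of_eq this
  have h1 := key (i - n * X.translationDistance g)
  have h2 := key (i - n * X.translationDistance g + 1)
  have h3 : n * (X.translationDistance g : ℤ) = m * X.translationDistance g := by omega
  have := hg.translationDistance_pos
  exact mul_right_cancel₀ (by exact_mod_cast this.ne') h3

/-- Clear for vertices of the axis; an arbitrary `x` is separated from an axis vertex by only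
finitely many translates of `H`. -/
lemma eventually_mem_of_mem_positiveAxis {H : Set V} (hH : H ∈ X.positiveAxis g) (x : V) :
    (∀ᶠ n : ℤ in atTop, (g ^ n) x ∈ H) ∧ ∀ᶠ n : ℤ in atBot, (g ^ n) x ∉ H := by
  have hfin := fun y z => (finite_setOf_preimage_mem hX hg hH y z).eventually_cofinite_notMem
  simp only [Int.cofinite_eq, eventually_sup] at hfin
  obtain ⟨γ, hγ, i, hi⟩ := hH
  have hl : (1 : ℤ) ≤ X.translationDistance g := by exact_mod_cast hg.translationDistance_pos
  constructor
  · filter_upwards [(hfin x (γ i)).2, eventually_ge_atTop 1] with n hn hn'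
    by_contra h
    refine hn ⟨hg.isHalfspace_zpow_preimage hX n hi.1, ?_, h⟩
    rw [Set.mem_preimage, hγ.zpow_apply, hγ.mem_iff hX hi]
    nlinarith
  · filter_upwards [(hfin (γ i) x).1, eventually_le_atBot 0] with n hn hn'
    intro h
    refine hn ⟨hg.isHalfspace_zpow_preimage hX n hi.1, h, ?_⟩
    rw [Set.mem_preimage, hγ.zpow_apply, hγ.mem_iff hX hi]
    nlinarith

/-- Every axis crosses all half-spaces of the positive half-space axis. -/
lemma IsCombinatorialAxis.mem_interval_of_mem_positiveAxis (hγ : X.IsCombinatorialAxis g γ)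
    {H : Set V} (hH : H ∈ X.positiveAxis g) : ∃ i, H ∈ X.interval (γ i) (γ (i + 1)) := by
  obtain ⟨h1, h2⟩ := eventually_mem_of_mem_positiveAxis hX hg hH (γ 0)
  obtain ⟨n, hn, hn'⟩ := (h1.and (eventually_ge_atTop 0)).exists
  obtain ⟨m, hm, hm'⟩ := (h2.and (eventually_le_atBot 0)).exists
  rw [hγ.zpow_apply] at hn hm
  obtain ⟨-, -, -, h, -⟩ := hH
  refine exists_mem_interval h ?_ hm hn
  have : (0 : ℤ) ≤ X.translationDistance g := by positivity
  nlinarith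

omit hX hg in
lemma compl_mem_halfspaceAxis {H : Set V} (h : H ∈ X.halfspaceAxis g) :
    Hᶜ ∈ X.halfspaceAxis g := by
  rcases h with h | h
  · exact Or.inr (by rwa [Set.mem_ofPred_eq, compl_compl])
  · exact Or.inl h

omit hg in
lemma isHalfspace_of_mem_halfspaceAxis {H : Set V} (h : H ∈ X.halfspaceAxis g) :
    X.IsHalfspace H := by
  rcases h with ⟨-, -, -, h, -⟩ | ⟨-, -, -, h, -⟩
  · exact h
  · exact compl_compl H ▸ hX.isHalfspace_compl h

lemma image_mem_positiveAxis {H : Set V} (h : H ∈ X.positiveAxis g) :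
    g '' H ∈ X.positiveAxis g := by
  obtain ⟨γ, hγ, i, h1, h2, h3⟩ := h
  refine ⟨γ, hγ, i + X.translationDistance g, ?_, ?_, ?_⟩
  · have := hg.isHalfspace_zpow_preimage hX (-1) h1
    rwa [Equiv.image_eq_preimage_symm, ← Equiv.Perm.inv_def, ← zpow_neg_one]
  · rw [show i + X.translationDistance g + 1 = i + 1 + X.translationDistance g by ring, ← hγ.2]
    exact Set.mem_image_of_mem g h2
  · rw [← hγ.2, g.injective.mem_set_image]
    exact h3

lemma image_mem_halfspaceAxis {H : Set V} (h : H ∈ X.halfspaceAxis g) :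
    g '' H ∈ X.halfspaceAxis g := by
  rcases h with h | h
  · exact Or.inl (image_mem_positiveAxis hX hg h)
  · refine Or.inr ?_
    rw [Set.mem_ofPred_eq, ← Set.image_compl_eq g.bijective]
    exact image_mem_positiveAxis hX hg h

omit hX hg in
/-- Half-spaces of the axis are transverse in the Sageev construction if and only if they are
transverse. -/
lemma transverseIn_iff {H K : Set V} (hH : H ∈ X.halfspaceAxis g) (hK : K ∈ X.halfspaceAxis g) :
    Sageev.TransverseIn (X.halfspaceAxis g) H K ↔ Transverse H K := by
  have key : ∀ {H K : Set V}, H ∈ X.halfspaceAxis g → K ∈ X.halfspaceAxis g →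
      ((Sageev.halfspace (X.halfspaceAxis g) H ∩
        Sageev.halfspace (X.halfspaceAxis g) K).Nonempty ↔ (H ∩ K).Nonempty) := by
    intro H K hH hK
    constructor
    · rintro ⟨σ, h1, h2⟩
      exact h1.1.1.2.2 H h1.2 K h2.2
    · rintro ⟨v, h1, h2⟩
      have := principal_mem_vertices (fun H h => compl_mem_halfspaceAxis (X := X) (g := g) h) v
      exact ⟨_, ⟨this, hH, h1⟩, this, hK, h2⟩
  have hH' := compl_mem_halfspaceAxis hH
  have hK' := compl_mem_halfspaceAxis hK
  rw [Sageev.TransverseIn, Transverse, key hH hK, key hH hK', key hH' hK, key hH' hK']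

/-- If `g` has an axis, then every minimal vertex is moved along a geodesic. -/
lemma IsCombinatorialAxis.dist_pow (hγ : X.IsCombinatorialAxis g γ) {x : V}
    (hx : X.graph.dist x (g x) = X.translationDistance g) (n : ℕ) :
    X.graph.dist x ((g ^ (n : ℤ)) x) = n * X.translationDistance g := by
  have hd := hg.dist_eq hX.2.1
  have htri := fun u v w => hX.2.1.dist_triangle (u := u) (v := v) (w := w)
  have hle : ∀ (m k : ℕ), X.graph.dist x ((g ^ ((m * k : ℕ) : ℤ)) x) ≤
      k * X.graph.dist x ((g ^ (m : ℤ)) x) := by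
    intro m k
    induction k with
    | zero => simp
    | succ k ih =>
      have h1 := htri x ((g ^ ((m * k : ℕ) : ℤ)) x) ((g ^ ((m * (k + 1) : ℕ) : ℤ)) x)
      rw [show ((m * (k + 1) : ℕ) : ℤ) = ((m * k : ℕ) : ℤ) + m by push_cast; ring, zpow_add,
        Equiv.Perm.mul_apply, hd] at h1
      rw [show ((m * (k + 1) : ℕ) : ℤ) = ((m * k : ℕ) : ℤ) + m by push_cast; ring, zpow_add,
        Equiv.Perm.mul_apply, add_mul, one_mul]
      omega
  have hle' := hle 1 n
  simp only [one_mul, Nat.cast_one, zpow_one, hx] at hle'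
  refine hle'.antisymm ?_
  by_contra hlt
  push Not at hlt
  set D := X.graph.dist x (γ 0) with hD
  -- A deficit of one in `n` steps becomes at least `2 * D + 1` after repetition, while the detour
  -- to the axis costs at most `2 * D`.
  have h1 := hle n (2 * D + 1)
  have h2 := htri (γ 0) x ((g ^ ((n * (2 * D + 1) : ℕ) : ℤ)) (γ 0))
  have h3 := htri x ((g ^ ((n * (2 * D + 1) : ℕ) : ℤ)) x) ((g ^ ((n * (2 * D + 1) : ℕ) : ℤ)) (γ 0))
  rw [hd, ← hD] at h3
  rw [SimpleGraph.dist_comm (u := γ 0) (v := x), ← hD, hγ.zpow_apply, hγ.1] at h2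
  rw [hγ.zpow_apply] at h3
  have h4 : ((0 : ℤ) - (0 + ((n * (2 * D + 1) : ℕ) : ℤ) * X.translationDistance g)).natAbs =
      (2 * D + 1) * (n * X.translationDistance g) := by
    rw [zero_add, zero_sub, Int.natAbs_neg, ← Nat.cast_mul, Int.natAbs_natCast]
    ring
  rw [h4] at h2
  have h5 : (2 * D + 1) * (X.graph.dist x ((g ^ (n : ℤ)) x) + 1) ≤
      (2 * D + 1) * (n * X.translationDistance g) := Nat.mul_le_mul_left _ hlt
  rw [mul_add, mul_one] at h5
  omega

/-- A minimal vertex that lies in `g H` lies in `H`, for `H` in the positive half-space axis. -/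
lemma mem_of_mem_image_of_minimal {H : Set V} (hH : H ∈ X.positiveAxis g) {x : V}
    (hx : X.graph.dist x (g x) = X.translationDistance g) (hxH : x ∈ g '' H) : x ∈ H := by
  obtain ⟨y, hy, rfl⟩ := hxH
  have hd := hg.dist_eq hX.2.1
  have hy' : X.graph.dist y (g y) = X.translationDistance g := by
    rw [← hx]
    exact (hd 1 _ _).symm
  obtain ⟨n, hn, hn'⟩ := ((eventually_mem_of_mem_positiveAxis hX hg hH (g y)).1.and
    (eventually_ge_atTop 0)).exists
  lift n to ℕ using hn'
  obtain ⟨γ, hγ, i, hi⟩ := hH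
  -- The vertex lies on a geodesic from `y ∈ H` to a far forward translate in `H`.
  refine hX.isGeodConvex hi.1 hy hn ?_
  have h1 := hγ.dist_pow hX hg hx n
  have h2 := hγ.dist_pow hX hg hy' (n + 1)
  rw [Nat.cast_add, Nat.cast_one, zpow_add_one, Equiv.Perm.mul_apply] at h2
  rw [h1, h2, hy']
  ring

/-- Half-spaces that are not transverse to their translates are moved into themselves. -/
lemma image_subset_of_not_transverse {H : Set V} (hH : H ∈ X.positiveAxis g)
    (h : ¬ Transverse H (g '' H)) : g '' H ⊆ H := by
  intro x hx
  by_contra hxH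
  apply h
  have hmem : ∀ n : ℤ, ∀ y, (g ^ (n + 1)) y ∈ g '' H ↔ (g ^ n) y ∈ H := by
    intro n y
    rw [add_comm, zpow_one_add, Equiv.Perm.mul_apply, g.injective.mem_set_image]
  obtain ⟨h1, h2⟩ := eventually_mem_of_mem_positiveAxis hX hg hH x
  -- The other three intersections contain a far forward translate of `x`, the axis vertex just
  -- after the crossing (as `1 ≤ ℓ`), and a far backward translate.
  refine ⟨?_, ?_, ⟨x, hxH, hx⟩, ?_⟩
  · obtain ⟨n, hn⟩ := (h1.and ((tendsto_atTop_add_const_right _ (-1 : ℤ) tendsto_id).eventually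
      h1)).exists
    refine ⟨_, hn.1, ?_⟩
    have := (hmem (n + -1) x).2 hn.2
    rwa [neg_add_cancel_right] at this
  · obtain ⟨γ, hγ, i, hi⟩ := hH
    refine ⟨γ (i + 1), hi.2.1, ?_⟩
    have h3 := hmem (-1) (γ (i + 1))
    rw [neg_add_cancel, hγ.zpow_apply, hγ.zpow_apply, hγ.mem_iff hX hi] at h3
    intro h4
    have := h3.1 (by simpa using h4)
    have := hg.translationDistance_pos
    omega
  · obtain ⟨n, hn⟩ := (h2.and ((tendsto_atBot_add_const_right _ (-1 : ℤ) tendsto_id).eventually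
      h2)).exists
    refine ⟨_, hn.1, ?_⟩
    have := (hmem (n + -1) x).not.2 hn.2
    rwa [neg_add_cancel_right] at this

end Axis

/-! ### The hull of an axis as a model of the essential characteristic set. -/

section Hull

variable {γ : ℤ → V}

/-- The intersection of all half-spaces that contain `γ`. -/
def axisHull (X : CubeComplex V) (γ : ℤ → V) : Set V :=
  {v | ∀ H, X.IsHalfspace H → (∀ i, γ i ∈ H) → v ∈ H}

lemma mem_axisHull (i : ℤ) : γ i ∈ X.axisHull γ := fun _ _ h => h i

variable (hX : X.IsCAT0)
include hX

lemma isGeodConvex_axisHull : X.IsGeodConvex (X.axisHull γ) :=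
  fun _ hx _ hy _ hz H hH h => hX.isGeodConvex hH (hx H hH h) (hy H hH h) hz

/-- Half-spaces that separate vertices of the hull of an axis belong to the half-space axis. -/
lemma IsCombinatorialAxis.mem_halfspaceAxis (hγ : X.IsCombinatorialAxis g γ) {p q : V}
    (hp : p ∈ X.axisHull γ) (hq : q ∈ X.axisHull γ) {H : Set V} (hH : X.IsHalfspace H)
    (hpH : p ∈ H) (hqH : q ∉ H) : H ∈ X.halfspaceAxis g := by
  have h1 : ∃ i, γ i ∉ H := by
    by_contra h
    push Not at h
    exact hqH (hq H hH h)
  have h2 : ∃ i, γ i ∈ H := by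
    by_contra h
    push Not at h
    exact hp Hᶜ (hX.isHalfspace_compl hH) h hpH
  obtain ⟨j, hj⟩ := h1
  obtain ⟨k, hk⟩ := h2
  rcases le_total j k with h | h
  · exact Or.inl ⟨γ, hγ, exists_mem_interval hH h hj hk⟩
  · exact Or.inr ⟨γ, hγ, exists_mem_interval (hX.isHalfspace_compl hH) h (by simpa) hj⟩

variable (hg : X.IsHyperbolic g)
include hg

/-- The hull of an axis projects onto the vertices of the essential characteristic set. -/
lemma IsCombinatorialAxis.exists_principal_eq (hγ : X.IsCombinatorialAxis g γ)
    {σ : Set (Set V)} (hσ : σ ∈ Sageev.vertices (X.halfspaceAxis g)) :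
    ∃ p ∈ X.axisHull γ, Sageev.principal (X.halfspaceAxis g) p = σ := by
  set A := X.halfspaceAxis g with hA
  obtain ⟨⟨hσA, hσx, hσi⟩, v, hv⟩ := hσ
  have hconv : ∀ H ∈ σ, X.IsGeodConvex H := fun H h =>
    hX.isGeodConvex (isHalfspace_of_mem_halfspaceAxis hX (hσA h))
  have hhull : ∀ H ∈ σ, (X.axisHull γ ∩ H).Nonempty := by
    intro H h
    rcases hσA h with h | h
    · obtain ⟨i, hi⟩ := hγ.mem_interval_of_mem_positiveAxis hX hg h
      exact ⟨_, mem_axisHull _, hi.2.1⟩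
    · obtain ⟨i, hi⟩ := hγ.mem_interval_of_mem_positiveAxis hX hg h
      exact ⟨_, mem_axisHull i, not_not.1 hi.2.2⟩
  -- Only finitely many members of `σ` miss `γ 0`, so finite Helly suffices for them; the gate of `γ
  -- 0` handles the rest.
  have hfin : (σ \ Sageev.principal A (γ 0)).Finite := by
    refine (hv.union (hX.finite_interval (γ 0) v)).subset ?_
    rintro H ⟨h1, h2⟩
    by_cases hvH : v ∈ H
    · exact Or.inr ⟨isHalfspace_of_mem_halfspaceAxis hX (hσA h1), hvH,
        fun h3 => h2 ⟨hσA h1, h3⟩⟩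
    · exact Or.inl (Or.inl ⟨h1, fun h3 => hvH h3.2⟩)
  set F := hfin.toFinset with hF
  have hFσ : ∀ H ∈ F, H ∈ σ := fun H h => (hfin.mem_toFinset.1 h).1
  have hhelly := fun {D : Set V} => hX.helly_finset F (f := id)
    (fun H h => hconv H (hFσ H h)) (fun H h K k => hσi H (hFσ H h) K (hFσ K k)) (D := D)
  have hDconv : X.IsGeodConvex (X.axisHull γ ∩ ⋂ H ∈ F, id H) := by
    refine (isGeodConvex_axisHull hX).inter fun x hx y hy z hz => ?_
    simp only [Set.mem_iInter] at hx hy ⊢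
    exact fun H h => hconv H (hFσ H h) (hx H h) (hy H h) hz
  obtain ⟨p, hp, hgate⟩ := hX.exists_gate hDconv (hhelly (isGeodConvex_axisHull hX)
    ⟨_, mem_axisHull 0⟩ fun H h => hhull H (hFσ H h)) (γ 0)
  have hsub : ∀ K ∈ σ, p ∈ K := by
    intro K hK
    by_cases hKF : K ∈ F
    · exact Set.mem_iInter₂.1 hp.2 K hKF
    have h0 : γ 0 ∈ K := by
      by_contra h0
      exact hKF (hfin.mem_toFinset.2 ⟨hK, fun h => h0 h.2⟩)
    -- Some `q ∈ K` satisfies the finitely many constraints, and `p` lies on a geodesic from `γ 0 ∈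
    -- K` to `q`.
    obtain ⟨q, hq, hqF⟩ := hhelly ((isGeodConvex_axisHull hX).inter (hconv K hK))
      ⟨_, mem_axisHull 0, h0⟩ fun H h => hX.helly (isGeodConvex_axisHull hX) (hconv K hK)
        (hconv H (hFσ H h)) (hhull K hK) (hhull H (hFσ H h)) (hσi K hK H (hFσ H h))
    exact hconv K hK h0 hq.2 (hgate q ⟨hq.1, hqF⟩)
  refine ⟨p, hp.1, Set.Subset.antisymm ?_ fun K hK => ⟨hσA hK, hsub K hK⟩⟩
  rintro H ⟨hHA, hpH⟩
  rcases hσx H hHA with h | h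
  · exact h.1
  · exact absurd hpH (hsub _ h.1)

lemma IsCombinatorialAxis.apply_mem_axisHull (hγ : X.IsCombinatorialAxis g γ) {x : V}
    (hx : x ∈ X.axisHull γ) : g x ∈ X.axisHull γ := by
  intro H hH h
  refine hx (g ⁻¹' H) (hX.isHalfspace_preimage (hg.isAutomorphism.dist_eq hX.2.1) hH) fun i => ?_
  rw [Set.mem_preimage, hγ.2]
  exact h _

/-- If `g` maps the half-spaces of the positive axis into themselves, then the vertices of the hull
of an axis are minimal. -/
lemma IsCombinatorialAxis.dist_eq_of_mem_axisHull (hγ : X.IsCombinatorialAxis g γ)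
    (hsub : ∀ H ∈ X.positiveAxis g, g '' H ⊆ H) {x : V} (hx : x ∈ X.axisHull γ) :
    X.graph.dist x (g x) = X.translationDistance g := by
  refine le_antisymm ?_ (Nat.sInf_le ⟨x, rfl⟩)
  have hl := hg.translationDistance_pos
  have hpos : ∀ H ∈ X.interval x (g x), H ∈ X.positiveAxis g := by
    rintro H ⟨h1, h2, h3⟩
    rcases hγ.mem_halfspaceAxis hX (hγ.apply_mem_axisHull hX hg hx) hx h1 h2 h3 with h | h
    · exact h
    · exact absurd h2 (hsub _ h (Set.mem_image_of_mem g h3))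
  have hpow : ∀ H ∈ X.positiveAxis g, ∀ (n : ℕ) y, y ∈ H → (g ^ (n : ℤ)) y ∈ H := by
    intro H hH n y hy
    induction n with
    | zero => simpa
    | succ n ih =>
      rw [Nat.cast_add, Nat.cast_one, add_comm, zpow_one_add, Equiv.Perm.mul_apply]
      exact hsub H hH (Set.mem_image_of_mem g ih)
  choose! f hf using fun H (hH : H ∈ X.interval x (g x)) =>
    hγ.mem_interval_of_mem_positiveAxis hX hg (hpos H hH)
  -- Crossing edges congruent modulo `ℓ` force `H = g⁻ⁿK`. For `n ≥ 1`, `gx ∈ K` would put `g¹⁻ⁿx`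
  -- in `H`, and pushing forward `x ∈ H`, a contradiction.
  have key : ∀ H ∈ X.interval x (g x), ∀ K ∈ X.interval x (g x), ∀ n : ℕ,
      f K = f H + n * X.translationDistance g → H = K := by
    intro H hH K hK n hn
    have h1 : (g ^ (n : ℤ) : Equiv.Perm V) ⁻¹' K ∈ X.interval (γ (f H)) (γ (f H + 1)) := by
      refine ⟨hg.isHalfspace_zpow_preimage hX n hK.1, ?_, ?_⟩
      · rw [Set.mem_preimage, hγ.zpow_apply, hγ.mem_iff hX (hf K hK), hn]
        omega
      · rw [Set.mem_preimage, hγ.zpow_apply, hγ.mem_iff hX (hf K hK), hn]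
        omega
    have h2 := hf H hH
    rw [hX.interval_of_adj (hγ.adj _), Set.mem_singleton_iff] at h1 h2
    have h3 : (g ^ (n : ℤ) : Equiv.Perm V) ⁻¹' K = H := h1.trans h2.symm
    cases n with
    | zero => simpa using h3.symm
    | succ n =>
      exfalso
      have h4 : (g ^ (-((n + 1 : ℕ) : ℤ))) (g x) ∈ H := by
        rw [← h3, Set.mem_preimage, ← Equiv.Perm.mul_apply, ← zpow_add]
        simpa using hK.2.1
      have h5 := hpow H (hpos H hH) n _ h4
      rw [← Equiv.Perm.mul_apply, ← Equiv.Perm.mul_apply, ← zpow_add, ← zpow_add_one] at h5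
      rw [show (n : ℤ) + -((n + 1 : ℕ) : ℤ) + 1 = 0 by push_cast; ring] at h5
      exact hH.2.2 (by simpa using h5)
  refine (hX.dist_le_ncard_interval x (g x)).trans ?_
  have h6 : (X.interval x (g x)).ncard ≤
      (Finset.Ico (0 : ℤ) (X.translationDistance g) : Set ℤ).ncard := by
    -- By `key`, the residue of the crossing edge modulo `ℓ` determines the half-space.
    refine Set.ncard_le_ncard_of_injOn (fun H => f H % X.translationDistance g) ?_ ?_
      (Finset.finite_toSet _)
    · intro H _
      rw [Finset.mem_coe, Finset.mem_Ico]
      exact ⟨Int.emod_nonneg _ (by omega), Int.emod_lt_of_pos _ (by omega)⟩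
    · intro H hH K hK hHK
      obtain ⟨m, hm⟩ := Int.ModEq.dvd hHK
      rcases le_total 0 m with h | h
      · lift m to ℕ using h
        exact key H hH K hK m (by rw [mul_comm] at hm; omega)
      · obtain ⟨k, rfl⟩ : ∃ k : ℕ, m = -k := ⟨m.natAbs, by omega⟩
        exact (key K hK H hH k (by rw [mul_comm, neg_mul] at hm; omega)).symm
  rw [Set.ncard_coe_finset, Int.card_Ico] at h6
  simpa using h6

/-- The cubes of the essential characteristic set come from cubes in the hull of an axis. -/
lemma IsCombinatorialAxis.exists_cube (hγ : X.IsCombinatorialAxis g γ)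
    {Q : Set (Set (Set V))} (hQ : Q ∈ X.essentialCharacteristicSet g) :
    ∃ C ∈ X.cubes, C ⊆ X.axisHull γ ∧ Q = Sageev.principal (X.halfspaceAxis g) '' C := by
  obtain ⟨n, φ, hφ, rfl, hφv, hφa⟩ := hQ
  choose p hp hpφ using fun a => hγ.exists_principal_eq hX hg (hφv a)
  have hinj : Function.Injective p := fun a b hab => hφ (by rw [← hpφ, hab, hpφ])
  have hcube : X.IsCubeMap p := by
    refine ⟨hinj, fun a i => ?_⟩
    obtain ⟨H, -, hH⟩ := hφa a i
    change φ (flipCoord a i) = _ at hH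
    rw [← hpφ, ← hpφ] at hH
    -- Half-spaces separating hull vertices belong to the half-space axis, where adjacent
    -- ultrafilters differ on one complementary pair only.
    refine hX.adj_of_interval_subset (H := Hᶜ)
      (fun h => flipCoord_ne a i (hinj h).symm) ?_
    rintro K ⟨h1, h2, h3⟩
    have h4 : K ∈ Sageev.principal (X.halfspaceAxis g) (p (flipCoord a i)) :=
      ⟨hγ.mem_halfspaceAxis hX (hp _) (hp _) h1 h2 h3, h2⟩
    rw [hH] at h4
    rcases h4 with h4 | h4
    · exact h4
    · exact absurd h4.1.2 h3
  refine ⟨Set.range p, hcube.range_mem_cubes hX, ?_, ?_⟩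
  · rintro _ ⟨a, rfl⟩
    exact hp a
  · rw [← Set.range_comp]
    exact congrArg Set.range (funext fun a => (hpφ a).symm)

end Hull

end CubeComplex

/-! ### The main equivalence. -/

theorem mainTheorem6 {V : Type*} (X : CubeComplex V) (hX : X.IsCAT0)
    (g : Equiv.Perm V) (hg : X.IsHyperbolic g) :
    (X.essentialMinimalSet g = X.essentialCharacteristicSet g ↔ X.ActsNonTransversely g) ∧
      (X.ActsNonTransversely g ↔ ∀ H ∈ X.halfspaceAxis g, ¬ Transverse H (g '' H)) := by
  have hnt : X.ActsNonTransversely g ↔ ∀ H ∈ X.halfspaceAxis g, ¬ Transverse H (g '' H) :=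
    forall₂_congr fun H hH => not_congr
      (CubeComplex.transverseIn_iff hH (CubeComplex.image_mem_halfspaceAxis hX hg hH))
  refine ⟨?_, hnt⟩
  rw [hnt]
  have hcube : ∀ {C : Set V}, C ∈ X.cubes →
      Sageev.principal (X.halfspaceAxis g) '' C ∈ X.essentialCharacteristicSet g :=
    fun hC => hX.image_principal_mem_cubes
      (fun H h => CubeComplex.isHalfspace_of_mem_halfspaceAxis hX h)
      (fun H h => CubeComplex.compl_mem_halfspaceAxis h) hC
  constructor
  · intro heq
    have key : ∀ H ∈ X.positiveAxis g, g '' H ⊆ H := by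
      intro H hH v hv
      -- The equality of cubes is used only for the `0`-cube that `v` defines: it yields a minimal
      -- `x` with the same projection.
      have h1 := hcube (X.singleton_mem v)
      rw [← heq] at h1
      obtain ⟨C, ⟨hC, hmin⟩, h2⟩ := h1
      rw [Set.image_singleton] at h2
      have h3 : Sageev.principal (X.halfspaceAxis g) v ∈
          Sageev.principal (X.halfspaceAxis g) '' C := h2 ▸ Set.mem_singleton _
      obtain ⟨x, hx, hxv⟩ := h3
      have hgH : g '' H ∈ Sageev.principal (X.halfspaceAxis g) x := by
        rw [hxv]
        exact ⟨Or.inl (CubeComplex.image_mem_positiveAxis hX hg hH), hv⟩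
      have hxH : H ∈ Sageev.principal (X.halfspaceAxis g) x :=
        ⟨Or.inl hH, CubeComplex.mem_of_mem_image_of_minimal hX hg hH (hmin x hx) hgH.2⟩
      rw [hxv] at hxH
      exact hxH.2
    rintro H (hH | hH) ⟨h1, h2, h3, h4⟩
    · obtain ⟨v, hv, hv'⟩ := h3
      exact hv (key H hH hv')
    · obtain ⟨v, hv, hv'⟩ := h2
      rw [← Set.image_compl_eq g.bijective] at hv'
      exact key _ hH hv' hv
  · intro h
    refine Set.Subset.antisymm ?_ ?_
    · rintro _ ⟨C, ⟨hC, -⟩, rfl⟩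
      exact hcube hC
    · intro Q hQ
      by_cases hax : ∃ γ, X.IsCombinatorialAxis g γ
      · obtain ⟨γ, hγ⟩ := hax
        obtain ⟨C, hC, hCγ, rfl⟩ := hγ.exists_cube hX hg hQ
        refine ⟨C, ⟨hC, fun v hv => ?_⟩, rfl⟩
        exact hγ.dist_eq_of_mem_axisHull hX hg (fun H hH =>
          CubeComplex.image_subset_of_not_transverse hX hg hH (h H (Or.inl hH))) (hCγ hv)
      -- Without axes the empty ultrafilter is the only vertex, and it is the image of a vertex
      -- attaining the infimum `ℓ`.
      · have hA : X.halfspaceAxis g = ∅ := by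
          rw [Set.eq_empty_iff_forall_notMem]
          rintro H (⟨γ, hγ, -⟩ | ⟨γ, hγ, -⟩) <;> exact hax ⟨γ, hγ⟩
        have := hX.2.1.nonempty
        obtain ⟨v, hv⟩ := Nat.sInf_mem (Set.range_nonempty fun v : V => X.graph.dist v (g v))
        refine ⟨{v}, ⟨X.singleton_mem v, ?_⟩, ?_⟩
        · rintro _ rfl
          exact hv
        · obtain ⟨n, φ, -, rfl, hφ, -⟩ := hQ
          have hφ' : ∀ a, φ a = Sageev.principal (X.halfspaceAxis g) v := by
            intro a
            have h1 := (hφ a).1.1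
            have h2 : Sageev.principal (X.halfspaceAxis g) v ⊆ X.halfspaceAxis g :=
              fun H h => h.1
            rw [hA, Set.subset_empty_iff] at h1
            rw [h1, eq_comm, ← Set.subset_empty_iff]
            exact h2.trans hA.subset
          rw [Set.image_singleton, show φ = fun _ => Sageev.principal (X.halfspaceAxis g) v from
            funext hφ', Set.range_const]
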